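/- Let $k$SSE be the following decision problem. An instance is a finite simple undirected graph $G=(V,E)$ with positive edge weights $w:E\to\mathbb{R}^+$, a positive integer $k$ and a rational number $N$; the question is whether there is a nonempty set $S\subseteq V$ with $|S|\le k$ and $$\phi_G(S)=\frac{w(E(S,V\setminus S))}{|S|}\le N,$$ where $E(S,V\setminus S)$ is the set of edges with exactly one endpoint in $S$. Let $n=|V|$ and let $d$ be the maximum degree of $G$. The graph is given by adjacency lists (in arbitrary order) together with the weights. **Theorem.** $k$SSE is fixed-parameter tractable when parameterized by $k$ and $d$ combined, and it can be solved deterministically in time $O(f(k,d)\, n\log n)$. More precisely, there is a single (deterministic) random access machine program, whose only arithmetic operations are addition, subtraction and comparison, such that: 1. For rational weights it is a fixed-parameter algorithm: there are a computable function $g:\mathbb{N}\times\mathbb{N}\to\mathbb{N}$ and a constant $c$ such that it decides every instance $x$ at a bit cost (logarithmic cost) of at most $g(k,d)\cdot|x|^c$, where $|x|$ is the bit length of $x$. 2. There is a computable function $f:\mathbb{N}\times\mathbb{N}\to\mathbb{N}$ such that it decides every instance with real weights (and, more generally, with weights in any linearly ordered field) in at most $f(k,d)\cdot(n\lfloor\log_2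 n\rfloor+1)$ steps, where each operation on numbers counts as one step (for $n\le 1$ the term $n\lfloor\log_2 n\rfloor$ is $0$). -/

import Mathlib

/-! ## Random access machines

A random access machine with two sorts of data: natural numbers (used for counting and for
addressing) and values in an ordered field `K` (`K = ℝ` is the real RAM; for `K = ℚ` bit costs are
defined below).  Arithmetic is restricted to addition, subtraction and comparison. -/

namespace RAM

/-- Instructions. The arguments `r`, `a`, `b` are register numbers, `t` is a jump target. -/
inductive Instr where
  /-- `reg r := c` -/
  | const (r c : ℕ)
  /-- `reg r := reg a + reg b` -/
  | add (r a b : ℕ)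
  /-- `reg r := reg a - reg b` (truncated) -/
  | sub (r a b : ℕ)
  /-- `reg r := mem (reg a)` -/
  | load (r a : ℕ)
  /-- `mem (reg a) := reg b` -/
  | store (a b : ℕ)
  /-- if `reg a ≤ reg b` then jump to `t` -/
  | jle (a b t : ℕ)
  /-- `vreg r := vreg a + vreg b` -/
  | vadd (r a b : ℕ)
  /-- `vreg r := vreg a - vreg b` -/
  | vsub (r a b : ℕ)
  /-- `vreg r := vmem (reg a)` -/
  | vload (r a : ℕ)
  /-- `vmem (reg a) := vreg b` -/
  | vstore (a b : ℕ)
  /-- if `vreg a ≤ vreg b` then jump to `t` -/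
  | vjle (a b t : ℕ)
  /-- halt and answer yes -/
  | accept
  /-- halt and answer no -/
  | reject

/-- A program is a finite list of instructions; it does not depend on `K`. -/
abbrev Program := List Instr

/-- A configuration: program counter, registers and memory, for both sorts. -/
structure Config (K : Type) where
  pc : ℕ
  reg : ℕ → ℕ
  mem : ℕ → ℕ
  vreg : ℕ → K
  vmem : ℕ → K

/-- An input: the initial contents of the two memories. -/
structure Input (K : Type) where
  nats : List ℕ
  vals : List K

section Semantics

variable {K : Type} [Field K] [LinearOrder K]

/-- Initially all registers are zero and the memories hold the input, padded by zeros. -/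
def init (x : Input K) : Config K where
  pc := 0
  reg := fun _ => 0
  mem := fun i => x.nats.getD i 0
  vreg := fun _ => 0
  vmem := fun i => x.vals.getD i 0

/-- The effect of one instruction. -/
def exec (c : Config K) : Instr → Config K
  | .const r m => { c with pc := c.pc + 1, reg := Function.update c.reg r m }
  | .add r a b => { c with pc := c.pc + 1, reg := Function.update c.reg r (c.reg a + c.reg b) }
  | .sub r a b => { c with pc := c.pc + 1, reg := Function.update c.reg r (c.reg a - c.reg b) }
  | .load r a => { c with pc := c.pc + 1, reg := Function.update c.reg r (c.mem (c.reg a)) }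
  | .store a b => { c with pc := c.pc + 1, mem := Function.update c.mem (c.reg a) (c.reg b) }
  | .jle a b t => { c with pc := if c.reg a ≤ c.reg b then t else c.pc + 1 }
  | .vadd r a b =>
      { c with pc := c.pc + 1, vreg := Function.update c.vreg r (c.vreg a + c.vreg b) }
  | .vsub r a b =>
      { c with pc := c.pc + 1, vreg := Function.update c.vreg r (c.vreg a - c.vreg b) }
  | .vload r a => { c with pc := c.pc + 1, vreg := Function.update c.vreg r (c.vmem (c.reg a)) }
  | .vstore a b => { c with pc := c.pc + 1, vmem := Function.update c.vmem (c.reg a) (c.vreg b) }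
  | .vjle a b t => { c with pc := if c.vreg a ≤ c.vreg b then t else c.pc + 1 }
  | .accept => c
  | .reject => c

/-- One step. A program counter outside the program blocks the machine without an answer. -/
def step (P : Program) (c : Config K) : Config K :=
  match P[c.pc]? with
  | none => c
  | some i => exec c i

/-- The configuration after `t` steps on input `x`. -/
def run (P : Program) (x : Input K) (t : ℕ) : Config K := (step P)^[t] (init x)

/-- After at most `T` steps on input `x` the program has halted, with answer yes if `ans` holds and
with answer no otherwise. -/
def DecidesIn (P : Program) (x : Input K) (T : ℕ) (ans : Prop) : Prop :=
  (ans ∧ P[(run P x T).pc]? = some Instr.accept) ∨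
    (¬ ans ∧ P[(run P x T).pc]? = some Instr.reject)

end Semantics

section BitCost

/-- The bit length of a rational number: that of its reduced numerator and denominator. -/
def ratSize (q : ℚ) : ℕ := q.num.natAbs.size + q.den.size

/-- The logarithmic cost of one instruction: one plus the bit lengths of all the operands,
including the address in a memory access. -/
def instrCost (c : Config ℚ) : Instr → ℕ
  | .const _ m => 1 + m.size
  | .add _ a b => 1 + (c.reg a).size + (c.reg b).size
  | .sub _ a b => 1 + (c.reg a).size + (c.reg b).size
  | .load _ a => 1 + (c.reg a).size + (c.mem (c.reg a)).size
  | .store a b => 1 + (c.reg a).size + (c.reg b).size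
  | .jle a b _ => 1 + (c.reg a).size + (c.reg b).size
  | .vadd _ a b => 1 + ratSize (c.vreg a) + ratSize (c.vreg b)
  | .vsub _ a b => 1 + ratSize (c.vreg a) + ratSize (c.vreg b)
  | .vload _ a => 1 + (c.reg a).size + ratSize (c.vmem (c.reg a))
  | .vstore a b => 1 + (c.reg a).size + ratSize (c.vreg b)
  | .vjle a b _ => 1 + ratSize (c.vreg a) + ratSize (c.vreg b)
  | .accept => 1
  | .reject => 1

/-- The logarithmic cost of the step taken in configuration `c`. -/
def stepCost (P : Program) (c : Config ℚ) : ℕ :=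
  match P[c.pc]? with
  | none => 1
  | some i => instrCost c i

/-- The bit complexity (logarithmic cost) of the first `T` steps on input `x`. -/
def bitCost (P : Program) (x : Input ℚ) (T : ℕ) : ℕ :=
  ∑ t ∈ Finset.range T, stepCost P (run P x t)

/-- The length of an input in bits, with one separator per number. -/
def Input.size (x : Input ℚ) : ℕ :=
  (x.nats.map fun m => m.size + 1).sum + (x.vals.map fun q => ratSize q + 1).sum

end BitCost

end RAM

/-! ## Parameterized problems -/

/-- A parameterized decision problem with a combined parameter consisting of two numbers: a type of
instances, the way an instance is written down, its parameters, and the set of yes-instances. -/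
structure ParamProblem where
  Inst : Type
  input : Inst → RAM.Input ℚ
  param : Inst → ℕ × ℕ
  Yes : Inst → Prop

/-- `P` is a fixed-parameter algorithm for `L`: there are a computable function `f` and a constant
`c` such that `P` decides every instance `x` in time at most `f (param x) * |x| ^ c`, where both the
time and the size `|x|` are measured in bits. -/
def ParamProblem.IsFixedParameterAlgorithm (L : ParamProblem) (P : RAM.Program) : Prop :=
  ∃ (f : ℕ × ℕ → ℕ) (c : ℕ), Computable f ∧
    ∀ x : L.Inst, ∃ T : ℕ,
      RAM.DecidesIn P (L.input x) T (L.Yes x) ∧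
      RAM.bitCost P (L.input x) T ≤ f (L.param x) * (L.input x).size ^ c

/-! ## Small-set expansion -/

section Expansion

variable {V K : Type} [Fintype V] [Field K]

open Classical in
/-- `E(S, Sᶜ)`: the edges of `G` with exactly one endpoint in `S`. -/
noncomputable def edgeCut (G : SimpleGraph V) (S : Finset V) : Finset (Sym2 V) :=
  {e ∈ G.edgeFinset | ∃ u ∈ S, ∃ v ∉ S, e = s(u, v)}

/-- The edge expansion `w(E(S, Sᶜ)) / |S|`, for nonempty `S`. -/
noncomputable def edgeExpansion (G : SimpleGraph V) (w : Sym2 V → K) (S : Finset V) : K :=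
  (∑ e ∈ edgeCut G S, w e) / (S.card : K)

end Expansion

/-- An instance of the small-set expansion problem: a graph on the vertices `0, …, n - 1` with
positive edge weights in `K` (the values of `weight` outside the edge set play no role), a positive
integer `k` and a rational number `N`. The graph is presented by adjacency lists, in which the
neighbours of a vertex are listed in an arbitrary order. -/
structure SSEInstance (K : Type) [Field K] [LinearOrder K] where
  n : ℕ
  graph : SimpleGraph (Fin n)
  weight : Sym2 (Fin n) → K
  weight_pos : ∀ e ∈ graph.edgeSet, 0 < weight e
  k : ℕ
  k_pos : 0 < k
  N : ℚ
  adj : Fin n → List (Fin n)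
  adj_nodup : ∀ v, (adj v).Nodup
  mem_adj : ∀ v u, u ∈ adj v ↔ graph.Adj v u

namespace SSEInstance

variable {K : Type} [Field K] [LinearOrder K]

/-- There is a nonempty set of at most `k` vertices with edge expansion at most `N`. -/
def Yes (x : SSEInstance K) : Prop :=
  ∃ S : Finset (Fin x.n), S.Nonempty ∧ S.card ≤ x.k ∧
    edgeExpansion x.graph x.weight S ≤ (x.N : K)

open Classical in
/-- The maximum degree of the graph. -/
noncomputable def maxDegree (x : SSEInstance K) : ℕ := x.graph.maxDegree

/-- `offset i` is the total length of the adjacency lists of the vertices `0, …, i - 1`. -/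
def offset (x : SSEInstance K) (i : ℕ) : ℕ :=
  (((List.finRange x.n).take i).map fun v => (x.adj v).length).sum

/-- The adjacency lists in memory. The first memory holds `n`, `k`, then
`offset 0, …, offset n`, then the concatenation of the adjacency lists; the second one holds `N`,
followed by the edge weights in the same order as the entries of the adjacency lists. -/
def input (x : SSEInstance K) : RAM.Input K where
  nats := [x.n, x.k] ++ (List.range (x.n + 1)).map x.offset ++
    (List.finRange x.n).flatMap fun v => (x.adj v).map fun u => (u : ℕ)
  vals := [(x.N : K)] ++
    (List.finRange x.n).flatMap fun v => (x.adj v).map fun u => x.weight s(v, u)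

end SSEInstance

/-- The problem `k`SSE (with rational weights, so that instances are finite strings),
parameterized by `k` and the maximum degree. -/
noncomputable def kSSE : ParamProblem where
  Inst := SSEInstance ℚ
  input := SSEInstance.input
  param := fun x => (x.k, x.maxDegree)
  Yes := SSEInstance.Yes

/-! Clearing the denominator, a set `S` is good when its cut weight is at most `|S| * N`. If `A` is
a connected component of `S`, no edge joins `A` to `S \ A`, so both sides of this inequality are
additive over `A` and `S \ A`; hence `A` or `S \ A` is good, and by induction some connected good
set has at most `k` vertices (`exists_good_desc`, `yes_iff`).

Every connected set arises from one of its vertices by repeatedly adding a neighbour. A list of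
fewer than `k` vertices has at most `k * d` such extensions, so each start vertex generates at most
`(1 + k * d) ^ k` lists (`potential_children`). The same set may be listed repeatedly; this costs
only a factor depending on `k` and `d`. The program explores the lists breadth first and computes
each cut weight from the adjacency lists, in time depending on `k` and `d` alone (`reach_head`). It
never needs to know `d`. The resulting bound is linear in `n` (`sse_decidesIn`), which is stronger
than `n log n`.

For bit costs, the only arithmetic is addition and subtraction, so all values remain integers over
the product of the input denominators and grow by at most one bit per step. `T` steps on an input of
size `X` thus cost `O(T * (X + T))` (`bitCost_le`), and `T` is at most a factor in `k` and `d` times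
`X`. -/

namespace RAM

/-! ### Bit costs -/

/-- `q` is an integer of fewer than `s` bits, up to the fixed denominator `D`. -/
def Scaled (D s : ℕ) (q : ℚ) : Prop := ∃ z : ℤ, q = z / D ∧ z.natAbs < 2 ^ s

theorem Scaled.mono {D s s' : ℕ} {q : ℚ} (h : Scaled D s q) (hs : s ≤ s') : Scaled D s' q := by
  obtain ⟨z, hz, hb⟩ := h
  exact ⟨z, hz, hb.trans_le (Nat.pow_le_pow_right (by norm_num) hs)⟩

theorem Scaled.add {D s : ℕ} {p q : ℚ} (hp : Scaled D s p) (hq : Scaled D s q) :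
    Scaled D (s + 1) (p + q) := by
  obtain ⟨y, rfl, hy⟩ := hp
  obtain ⟨z, rfl, hz⟩ := hq
  refine ⟨y + z, by push_cast; ring, ?_⟩
  rw [pow_succ]
  omega

theorem Scaled.sub {D s : ℕ} {p q : ℚ} (hp : Scaled D s p) (hq : Scaled D s q) :
    Scaled D (s + 1) (p - q) := by
  obtain ⟨y, rfl, hy⟩ := hp
  obtain ⟨z, rfl, hz⟩ := hq
  refine ⟨y - z, by push_cast; ring, ?_⟩
  rw [pow_succ]
  omega

/-- Reducing `z / D` only shrinks it: the reduced numerator divides `z` (if nonzero) and the reduced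
denominator divides `D`. -/
theorem Scaled.ratSize_le {D s : ℕ} (hD : 0 < D) (hDs : D < 2 ^ s) {q : ℚ} (h : Scaled D s q) :
    ratSize q ≤ 2 * s := by
  obtain ⟨z, rfl, hz⟩ := h
  have hnum : ((z : ℚ) / D).num.natAbs < 2 ^ s := by
    rcases eq_or_ne z 0 with rfl | hz0
    · simp
    · have := Rat.num_dvd z (b := (D : ℤ)) (by exact_mod_cast hD.ne')
      rw [Rat.divInt_eq_div] at this
      exact (Nat.le_of_dvd (Int.natAbs_pos.2 hz0) (Int.natAbs_dvd_natAbs.2 this)).trans_lt hz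
  have hden : ((z : ℚ) / D).den < 2 ^ s := by
    have := Rat.den_dvd z (D : ℤ)
    rw [Rat.divInt_eq_div] at this
    exact (Nat.le_of_dvd hD (Int.natCast_dvd_natCast.1 this)).trans_lt hDs
  have h1 := Nat.size_le.2 hnum
  have h2 := Nat.size_le.2 hden
  unfold ratSize
  omega

/-- All the numbers in the configuration have about `s` bits. -/
structure Config.Bounded (D s : ℕ) (c : Config ℚ) : Prop where
  reg : ∀ i, c.reg i < 2 ^ s
  mem : ∀ i, c.mem i < 2 ^ s
  vreg : ∀ i, Scaled D s (c.vreg i)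
  vmem : ∀ i, Scaled D s (c.vmem i)

theorem Config.Bounded.mono {D s s' : ℕ} {c : Config ℚ} (h : c.Bounded D s) (hs : s ≤ s') :
    c.Bounded D s' where
  reg i := (h.reg i).trans_le (Nat.pow_le_pow_right (by norm_num) hs)
  mem i := (h.mem i).trans_le (Nat.pow_le_pow_right (by norm_num) hs)
  vreg i := (h.vreg i).mono hs
  vmem i := (h.vmem i).mono hs

theorem forall_update {α : Type*} {p : α → Prop} {f : ℕ → α} (hf : ∀ i, p (f i)) (r : ℕ) {a : α}
    (ha : p a) (i : ℕ) : p (Function.update f r a i) := by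
  rcases eq_or_ne i r with rfl | h
  · simpa using ha
  · simpa [h] using hf i

/-- The constants that occur in an instruction are less than `b`. -/
def Instr.ConstLT (b : ℕ) : Instr → Prop
  | .const _ m => m < b
  | _ => True

theorem Config.Bounded.exec {D s : ℕ} {c : Config ℚ} (h : c.Bounded D s) {i : Instr}
    (hi : i.ConstLT (2 ^ s)) : (exec c i).Bounded D (s + 1) := by
  have h' := h.mono (Nat.le_succ s)
  cases i with
  | const r m =>
    exact ⟨forall_update (p := (· < 2 ^ (s + 1))) h'.reg r
      (hi.trans_le (Nat.pow_le_pow_right (by norm_num) (Nat.le_succ s))), h'.mem, h'.vreg, h'.vmem⟩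
  | add r a b =>
    refine ⟨forall_update (p := (· < 2 ^ (s + 1))) h'.reg r ?_, h'.mem, h'.vreg, h'.vmem⟩
    have := h.reg a
    have := h.reg b
    rw [pow_succ]
    omega
  | sub r a b =>
    exact ⟨forall_update (p := (· < 2 ^ (s + 1))) h'.reg r
      ((Nat.sub_le _ _).trans_lt (h'.reg a)), h'.mem, h'.vreg, h'.vmem⟩
  | load r a =>
    exact ⟨forall_update (p := (· < 2 ^ (s + 1))) h'.reg r (h'.mem _), h'.mem, h'.vreg, h'.vmem⟩
  | store a b =>
    exact ⟨h'.reg, forall_update (p := (· < 2 ^ (s + 1))) h'.mem _ (h'.reg b), h'.vreg, h'.vmem⟩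
  | jle a b t => exact ⟨h'.reg, h'.mem, h'.vreg, h'.vmem⟩
  | vadd r a b =>
    exact ⟨h'.reg, h'.mem, forall_update h'.vreg r ((h.vreg a).add (h.vreg b)), h'.vmem⟩
  | vsub r a b =>
    exact ⟨h'.reg, h'.mem, forall_update h'.vreg r ((h.vreg a).sub (h.vreg b)), h'.vmem⟩
  | vload r a => exact ⟨h'.reg, h'.mem, forall_update h'.vreg r (h'.vmem _), h'.vmem⟩
  | vstore a b => exact ⟨h'.reg, h'.mem, h'.vreg, forall_update h'.vmem _ (h'.vreg b)⟩
  | vjle a b t => exact ⟨h'.reg, h'.mem, h'.vreg, h'.vmem⟩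
  | accept => exact h'
  | reject => exact h'

theorem Config.Bounded.step {D s : ℕ} {c : Config ℚ} (h : c.Bounded D s) {P : Program}
    (hP : ∀ i ∈ P, i.ConstLT (2 ^ s)) : (step P c).Bounded D (s + 1) := by
  unfold RAM.step
  split
  · exact h.mono (Nat.le_succ s)
  · next i hi => exact h.exec (hP i (List.mem_of_getElem? hi))

theorem Instr.ConstLT.mono {b b' : ℕ} {i : Instr} (h : i.ConstLT b) (hb : b ≤ b') :
    i.ConstLT b' := by
  cases i <;> first | exact lt_of_lt_of_le h hb | trivial

theorem Config.Bounded.run {D s : ℕ} {P : Program} {x : Input ℚ} (h : (init x).Bounded D s)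
    (hP : ∀ i ∈ P, i.ConstLT (2 ^ s)) (t : ℕ) : (run P x t).Bounded D (s + t) := by
  induction t with
  | zero => exact h
  | succ t ih =>
    rw [RAM.run, Function.iterate_succ_apply']
    exact ih.step fun i hi => (hP i hi).mono (Nat.pow_le_pow_right (by norm_num) (by omega))

theorem Config.Bounded.stepCost_le {D s : ℕ} (hD : 0 < D) (hDs : D < 2 ^ s) {c : Config ℚ}
    (h : c.Bounded D s) {P : Program} (hP : ∀ i ∈ P, i.ConstLT (2 ^ s)) :
    stepCost P c ≤ 1 + 4 * s := by
  have hr := fun i => Nat.size_le.2 (h.reg i)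
  have hm := fun i => Nat.size_le.2 (h.mem i)
  have hvr := fun i => (h.vreg i).ratSize_le hD hDs
  have hvm := fun i => (h.vmem i).ratSize_le hD hDs
  unfold stepCost
  split
  · omega
  next i hi =>
  cases i with
  | const r m =>
    have := Nat.size_le.2 (show m < 2 ^ s from hP _ (List.mem_of_getElem? hi))
    simp only [instrCost]
    omega
  | add r a b => have := hr a; have := hr b; simp only [instrCost]; omega
  | sub r a b => have := hr a; have := hr b; simp only [instrCost]; omega
  | load r a => have := hr a; have := hm (c.reg a); simp only [instrCost]; omega
  | store a b => have := hr a; have := hr b; simp only [instrCost]; omega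
  | jle a b t => have := hr a; have := hr b; simp only [instrCost]; omega
  | vadd r a b => have := hvr a; have := hvr b; simp only [instrCost]; omega
  | vsub r a b => have := hvr a; have := hvr b; simp only [instrCost]; omega
  | vload r a => have := hr a; have := hvm (c.reg a); simp only [instrCost]; omega
  | vstore a b => have := hr a; have := hvr b; simp only [instrCost]; omega
  | vjle a b t => have := hvr a; have := hvr b; simp only [instrCost]; omega
  | accept => simp only [instrCost]; omega
  | reject => simp only [instrCost]; omega

theorem prod_den_le (l : List ℚ) :
    (l.map Rat.den).prod ≤ 2 ^ (l.map fun q => ratSize q + 1).sum := by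
  induction l with
  | nil => simp
  | cons q l ih =>
    simp only [List.map_cons, List.prod_cons, List.sum_cons, pow_add]
    have h1 : q.den < 2 ^ ratSize q :=
      (Nat.lt_size_self _).trans_le (Nat.pow_le_pow_right (by norm_num) (Nat.le_add_left _ _))
    exact Nat.mul_le_mul (h1.le.trans (Nat.le_mul_of_pos_right _ (by norm_num))) ih

theorem prod_den_pos (l : List ℚ) : 0 < (l.map Rat.den).prod :=
  List.prod_pos (by simp +contextual [Rat.den_pos])

theorem lt_of_mem_sum {α : Type*} {f : α → ℕ} {l : List α} {a : α} (h : a ∈ l) :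
    f a ≤ (l.map f).sum :=
  List.single_le_sum (by simp) _ (List.mem_map_of_mem h)

/-- Over the common denominator `D` the numerator becomes `q.num * m` with `m = D / q.den`. Both
factors are bounded by 2 to the total bit length, whence the factor 2 in the exponent. -/
theorem scaled_of_mem {l : List ℚ} {q : ℚ} (h : q ∈ l) :
    Scaled (l.map Rat.den).prod (2 * (l.map fun q => ratSize q + 1).sum) q := by
  obtain ⟨m, hm⟩ : q.den ∣ (l.map Rat.den).prod := List.dvd_prod (List.mem_map_of_mem h)
  have hpos := prod_den_pos l
  have hle' := prod_den_le l
  have hle := lt_of_mem_sum (f := fun q => ratSize q + 1) h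
  set D := (l.map Rat.den).prod
  have hm0 : m ≠ 0 := by rintro rfl; simp [hm] at hpos
  refine ⟨q.num * m, ?_, ?_⟩
  · have h1 : (q.den : ℚ) ≠ 0 := by exact_mod_cast q.den_ne_zero
    have h2 : (m : ℚ) ≠ 0 := by exact_mod_cast hm0
    rw [hm]
    push_cast
    rw [mul_div_mul_right _ _ h2, Rat.num_div_den]
  · rw [Int.natAbs_mul, Int.natAbs_natCast, two_mul, pow_add]
    have h3 : q.num.natAbs < 2 ^ (l.map fun q => ratSize q + 1).sum :=
      (Nat.lt_size_self _).trans_le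
        (Nat.pow_le_pow_right (by norm_num) (by simp only [ratSize] at hle ⊢; omega))
    have h4 : m ≤ D := Nat.le_of_dvd hpos ⟨q.den, by rw [hm, mul_comm]⟩
    exact Nat.mul_lt_mul_of_lt_of_le h3 (h4.trans hle') (by positivity)

theorem init_bounded (x : Input ℚ) :
    (init x).Bounded (x.vals.map Rat.den).prod (2 * x.size) := by
  have hz : Scaled (x.vals.map Rat.den).prod (2 * x.size) 0 := ⟨0, by simp, by simp⟩
  refine ⟨fun _ => by simp [init], fun i => ?_, fun _ => hz, fun i => ?_⟩
  · simp only [init, List.getD_eq_getElem?_getD]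
    rcases h : x.nats[i]? with _ | m
    · simp
    · have h1 := lt_of_mem_sum (f := fun m : ℕ => m.size + 1) (List.mem_of_getElem? h)
      refine (Nat.lt_size_self _).trans_le (Nat.pow_le_pow_right (by norm_num) ?_)
      simp only [Input.size, Option.getD_some] at h1 ⊢
      omega
  · simp only [init, List.getD_eq_getElem?_getD]
    rcases h : x.vals[i]? with _ | q
    · exact hz
    · refine (scaled_of_mem (List.mem_of_getElem? h)).mono ?_
      simp only [Input.size]
      omega

/-- Since an operation makes numbers longer by at most one bit, the logarithmic cost is polynomial
in the number of steps and the length of the input. -/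
theorem bitCost_le {P : Program} {x : Input ℚ} (hP : ∀ i ∈ P, i.ConstLT (2 ^ (2 * x.size + 1)))
    (T : ℕ) : bitCost P x T ≤ T * (1 + 4 * (2 * x.size + 1 + T)) := by
  unfold bitCost
  refine (Finset.sum_le_card_nsmul _ _ (1 + 4 * (2 * x.size + 1 + T)) fun t ht => ?_).trans
    (by simp)
  have ht := Finset.mem_range.1 ht
  refine ((((init_bounded x).mono (Nat.le_succ _)).run hP t).stepCost_le (prod_den_pos _) ?_ ?_).trans
    (by omega)
  -- The extra bit in `2 * x.size + 1` makes this inequality strict whatever the input size.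
  · refine (prod_den_le _).trans_lt (Nat.pow_lt_pow_right (by norm_num) ?_)
    simp only [Input.size]
    omega
  · exact fun i hi => (hP i hi).mono (Nat.pow_le_pow_right (by norm_num) (by omega))

end RAM

namespace SSEInstance

variable {K : Type} [Field K] [LinearOrder K]

/-! ### Connected sets -/

/-- The neighbours of `u` outside `l`. -/
def outer (x : SSEInstance K) (l : List (Fin x.n)) (u : Fin x.n) : List (Fin x.n) :=
  (x.adj u).filter (· ∉ l)

/-- The total weight of the edges leaving `l`. -/
def cutWeight (x : SSEInstance K) (l : List (Fin x.n)) : K :=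
  (l.map fun u => ((x.outer l u).map fun y => x.weight s(u, y)).sum).sum

/-- The extensions of `l` by an element of `s` outside `l`, as long as the size does not exceed
`k`. -/
def extend (x : SSEInstance K) (l s : List (Fin x.n)) : List (List (Fin x.n)) :=
  if l.length < x.k then (s.filter (· ∉ l)).map (· :: l) else []

/-- The extensions of `l` by a neighbour, as long as the size does not exceed `k`. -/
def children (x : SSEInstance K) (l : List (Fin x.n)) : List (List (Fin x.n)) :=
  l.flatMap fun u => x.extend l (x.adj u)

/-- `l'` is obtained from `l` by repeated extension. -/
def Desc (x : SSEInstance K) : List (Fin x.n) → List (Fin x.n) → Prop :=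
  Relation.ReflTransGen fun l l' => l' ∈ x.children l

/-- `l` lists a set of small expansion. -/
def Good (x : SSEInstance K) (l : List (Fin x.n)) : Prop :=
  x.cutWeight l ≤ (l.map fun _ => (x.N : K)).sum

/-- `l` lists a nonempty set of at most `k` vertices. -/
structure Valid (x : SSEInstance K) (l : List (Fin x.n)) : Prop where
  nodup : l.Nodup
  ne_nil : l ≠ []
  length_le : l.length ≤ x.k

theorem mem_outer {x : SSEInstance K} {l : List (Fin x.n)} {u y : Fin x.n} :
    y ∈ x.outer l u ↔ x.graph.Adj u y ∧ y ∉ l := by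
  simp [outer, x.mem_adj]

theorem mem_children {x : SSEInstance K} {l l' : List (Fin x.n)} :
    l' ∈ x.children l ↔
      l.length < x.k ∧ ∃ u ∈ l, ∃ y, x.graph.Adj u y ∧ y ∉ l ∧ l' = y :: l := by
  unfold children extend
  split
  · next h => simp [h, x.mem_adj, and_assoc, @eq_comm _ l']
  · next h => simp [h]

theorem Valid.child {x : SSEInstance K} {l l' : List (Fin x.n)} (h : x.Valid l)
    (hl : l' ∈ x.children l) : x.Valid l' := by
  obtain ⟨hk, u, -, y, -, hy, rfl⟩ := mem_children.1 hl
  exact ⟨List.nodup_cons.2 ⟨hy, h.nodup⟩, by simp, by simpa using hk⟩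

theorem Valid.desc {x : SSEInstance K} {l l' : List (Fin x.n)} (h : x.Valid l)
    (hl : x.Desc l l') : x.Valid l' := by
  induction hl with
  | refl => exact h
  | tail _ hc ih => exact ih.child hc

open Classical in
/-- The total weight of the edges leaving `S`. -/
noncomputable def setCut (x : SSEInstance K) (S : Finset (Fin x.n)) : K :=
  ∑ u ∈ S, ∑ y with x.graph.Adj u y ∧ y ∉ S, x.weight s(u, y)

/-- A cut edge has exactly one endpoint in `S`, so cut edges correspond bijectively to ordered pairs
(inner endpoint, outer endpoint). -/
theorem sum_edgeCut (x : SSEInstance K) (S : Finset (Fin x.n)) :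
    ∑ e ∈ edgeCut x.graph S, x.weight e = x.setCut S := by
  classical
  have h : edgeCut x.graph S = (S.sigma fun u => {y | x.graph.Adj u y ∧ y ∉ S}).image
      fun p => s(p.1, p.2) := by
    ext e
    simp only [edgeCut, Finset.mem_filter, Finset.mem_image, Finset.mem_sigma, Finset.mem_univ,
      true_and, SimpleGraph.mem_edgeFinset, Sigma.exists]
    constructor
    · rintro ⟨he, u, hu, v, hv, rfl⟩
      exact ⟨u, v, ⟨hu, he, hv⟩, rfl⟩
    · rintro ⟨u, v, ⟨hu, he, hv⟩, rfl⟩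
      exact ⟨he, u, hu, v, hv, rfl⟩
  rw [h, Finset.sum_image, Finset.sum_sigma, setCut]
  rintro ⟨u, y⟩ hp ⟨u', y'⟩ hp' he
  simp only [Finset.coe_sigma, Set.mem_sigma_iff, Finset.mem_coe, Finset.mem_filter,
    Finset.mem_univ, true_and] at hp hp'
  rcases Sym2.eq_iff.1 he with ⟨h1, h2⟩ | ⟨h1, h2⟩
  · simp only at h1 h2
    subst h1 h2
    rfl
  -- If the pairs were swapped, one vertex would lie both inside and outside `S`.
  · simp only at h1 h2
    subst h1 h2
    exact absurd hp'.1 hp.2.2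

theorem cutWeight_eq (x : SSEInstance K) {l : List (Fin x.n)} (h : l.Nodup) :
    x.cutWeight l = x.setCut l.toFinset := by
  classical
  rw [cutWeight, setCut, List.sum_toFinset _ h]
  congr 1
  refine List.map_congr_left fun u _ => ?_
  rw [outer, ← List.sum_toFinset _ ((x.adj_nodup u).filter _)]
  refine Finset.sum_congr ?_ fun _ _ => rfl
  ext y
  have := mem_outer (l := l) (u := u) (y := y)
  simpa [outer] using this

theorem edgeExpansion_le_iff [IsStrictOrderedRing K] (x : SSEInstance K) {S : Finset (Fin x.n)}
    (h : S.Nonempty) :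
    edgeExpansion x.graph x.weight S ≤ (x.N : K) ↔ x.setCut S ≤ (S.card : K) * x.N := by
  rw [edgeExpansion, sum_edgeCut, div_le_iff₀ (by exact_mod_cast h.card_pos), mul_comm]

theorem good_iff (x : SSEInstance K) {l : List (Fin x.n)} (h : l.Nodup) :
    x.Good l ↔ x.setCut l.toFinset ≤ (l.toFinset.card : K) * x.N := by
  rw [Good, cutWeight_eq x h, List.toFinset_card_of_nodup h]
  simp

theorem Valid.yes [IsStrictOrderedRing K] {x : SSEInstance K} {l : List (Fin x.n)} (h : x.Valid l)
    (hg : x.Good l) : x.Yes := by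
  have hne : l.toFinset.Nonempty := (List.toFinset_nonempty_iff _).2 h.ne_nil
  exact ⟨l.toFinset, hne, (List.toFinset_card_le l).trans h.length_le,
    (x.edgeExpansion_le_iff hne).2 ((x.good_iff h.nodup).1 hg)⟩

/-- Every set of at most `k` vertices contains a component, listed by a descendant of a vertex. -/
theorem exists_component (x : SSEInstance K) {S : Finset (Fin x.n)} (hk : S.card ≤ x.k)
    (v : Fin x.n) (hv : v ∈ S) :
    ∃ l, x.Desc [v] l ∧ (∀ u ∈ l, u ∈ S) ∧ l.Nodup ∧ l ≠ [] ∧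
      ∀ u ∈ l, ∀ y, x.graph.Adj u y → y ∈ S → y ∈ l := by
  by_contra! hno
  -- If no list is closed, each can be extended inside `S`, giving duplicate-free lists in `S` of
  -- every positive length; length `S.card + 1` is absurd.
  have key : ∀ m : ℕ, ∃ l, x.Desc [v] l ∧ (∀ u ∈ l, u ∈ S) ∧ l.Nodup ∧ l ≠ [] ∧
      l.length = m + 1 := by
    intro m
    induction m with
    | zero => exact ⟨[v], .refl, by simpa using hv, by simp, by simp, rfl⟩
    | succ m ih =>
      obtain ⟨l, hd, hS, hn, hne, hlen⟩ := ih
      obtain ⟨u, hu, y, huy, hyS, hyl⟩ := hno l hd hS hn hne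
      have hS' : ∀ z ∈ y :: l, z ∈ S := by simpa using ⟨hyS, hS⟩
      have hn' : (y :: l).Nodup := List.nodup_cons.2 ⟨hyl, hn⟩
      refine ⟨y :: l, hd.tail (mem_children.2 ⟨?_, u, hu, y, huy, hyl, rfl⟩), hS', hn', by simp,
        by simp [hlen]⟩
      -- The extended list still fits into `S`, so `l` is shorter than `k` and the extension is
      -- allowed.
      have : (y :: l).toFinset.card ≤ S.card :=
        Finset.card_le_card fun z hz => hS' z (by simpa using hz)
      rw [List.toFinset_card_of_nodup hn', List.length_cons] at this
      omega
  obtain ⟨l, -, hS, hn, -, hlen⟩ := key S.card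
  have : l.toFinset.card ≤ S.card := Finset.card_le_card fun z hz => hS z (by simpa using hz)
  rw [List.toFinset_card_of_nodup hn] at this
  omega

/-- No edge joins `A` to `S \ A`, so an edge leaving either part already leaves `S`. -/
theorem setCut_split (x : SSEInstance K) {A S : Finset (Fin x.n)} (hA : A ⊆ S)
    (h : ∀ u ∈ A, ∀ y, x.graph.Adj u y → y ∈ S → y ∈ A) :
    x.setCut S = x.setCut A + x.setCut (S \ A) := by
  classical
  rw [setCut, ← Finset.sum_sdiff hA, add_comm]
  congr 1
  · refine Finset.sum_congr rfl fun u hu => Finset.sum_congr ?_ fun _ _ => rfl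
    ext y
    simp only [Finset.mem_filter, Finset.mem_univ, true_and]
    exact ⟨fun hy => ⟨hy.1, fun hyA => hy.2 (hA hyA)⟩, fun hy => ⟨hy.1, fun hyS =>
      hy.2 (h u hu y hy.1 hyS)⟩⟩
  · refine Finset.sum_congr rfl fun u hu => Finset.sum_congr ?_ fun _ _ => rfl
    ext y
    rw [Finset.mem_sdiff] at hu
    simp only [Finset.mem_filter, Finset.mem_univ, true_and, Finset.mem_sdiff, not_and, not_not]
    exact ⟨fun hy => ⟨hy.1, fun hyS => absurd hyS hy.2⟩, fun hy => ⟨hy.1, fun hyS =>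
      hu.2 (h y (hy.2 hyS) u hy.1.symm hu.1)⟩⟩

/-- Strong induction on `S`: split off a component. If it is not good, its cut exceeds its share of
`|S| * N`, so the remainder satisfies the inequality strictly. -/
theorem exists_good_desc [IsStrictOrderedRing K] (x : SSEInstance K) (S : Finset (Fin x.n))
    (hne : S.Nonempty) (hk : S.card ≤ x.k) (hS : x.setCut S ≤ (S.card : K) * x.N) :
    ∃ v l, x.Desc [v] l ∧ x.Good l := by
  classical
  induction S using Finset.strongInduction with
  | H S ih =>
    obtain ⟨v, hv⟩ := hne
    obtain ⟨l, hd, hl, hn, hnil, hclosed⟩ := x.exists_component hk v hv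
    have hA : l.toFinset ⊆ S := fun u hu => hl u (by simpa using hu)
    by_cases hg : x.Good l
    · exact ⟨v, l, hd, hg⟩
    rw [x.good_iff hn, not_le] at hg
    have hsplit := x.setCut_split hA (by simpa using hclosed)
    have hcard := Finset.card_sdiff_add_card_eq_card hA
    have hcard' : (S.card : K) = ((S \ l.toFinset).card : K) + (l.toFinset.card : K) := by
      exact_mod_cast hcard.symm
    rw [hsplit, hcard', add_mul] at hS
    have hlt : x.setCut (S \ l.toFinset) < ((S \ l.toFinset).card : K) * x.N := by linarith
    refine ih (S \ l.toFinset) (Finset.sdiff_ssubset hA ((List.toFinset_nonempty_iff _).2 hnil)) ?_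
      (by omega) hlt.le
    -- An empty remainder would turn the strict inequality into `0 < 0`.
    rw [Finset.nonempty_iff_ne_empty]
    intro h0
    simp [h0, setCut] at hlt

theorem yes_iff [IsStrictOrderedRing K] (x : SSEInstance K) :
    x.Yes ↔ ∃ v l, x.Desc [v] l ∧ x.Good l := by
  constructor
  · rintro ⟨S, hne, hk, hS⟩
    exact x.exists_good_desc S hne hk ((x.edgeExpansion_le_iff hne).1 hS)
  · rintro ⟨v, l, hd, hg⟩
    have hv : x.Valid [v] := ⟨by simp, by simp, x.k_pos⟩
    exact (hv.desc hd).yes hg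

end SSEInstance

namespace RAM

/-! ### Reasoning about runs -/

section Reach

variable {K : Type} [Field K] [LinearOrder K] {P : Program}

/-- Starting from `c`, after at most `t` steps the configuration satisfies `Q`. -/
def Reach (P : Program) (c : Config K) (t : ℕ) (Q : Config K → Prop) : Prop :=
  ∃ s ≤ t, Q ((step P)^[s] c)

theorem Reach.here {c : Config K} {t : ℕ} {Q : Config K → Prop} (h : Q c) : Reach P c t Q :=
  ⟨0, Nat.zero_le t, h⟩

theorem Reach.mono {c : Config K} {t t' : ℕ} {Q : Config K → Prop} (h : Reach P c t Q)
    (ht : t ≤ t') : Reach P c t' Q :=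
  let ⟨s, hs, hq⟩ := h
  ⟨s, hs.trans ht, hq⟩

theorem Reach.imp {c : Config K} {t : ℕ} {Q Q' : Config K → Prop} (h : Reach P c t Q)
    (hq : ∀ c', Q c' → Q' c') : Reach P c t Q' :=
  let ⟨s, hs, hc⟩ := h
  ⟨s, hs, hq _ hc⟩

theorem Reach.trans {c : Config K} {t₁ t₂ : ℕ} {Q₁ Q₂ : Config K → Prop} (h₁ : Reach P c t₁ Q₁)
    (h₂ : ∀ c', Q₁ c' → Reach P c' t₂ Q₂) : Reach P c (t₁ + t₂) Q₂ := by
  obtain ⟨s₁, hs₁, hq₁⟩ := h₁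
  obtain ⟨s₂, hs₂, hq₂⟩ := h₂ _ hq₁
  exact ⟨s₂ + s₁, by omega, by rwa [Function.iterate_add_apply]⟩

theorem Reach.exec {c : Config K} {t : ℕ} {Q : Config K → Prop} {i : Instr}
    (hi : P[c.pc]? = some i) (h : Reach P (exec c i) t Q) : Reach P c (t + 1) Q := by
  obtain ⟨s, hs, hq⟩ := h
  refine ⟨s + 1, by omega, ?_⟩
  rw [Function.iterate_succ_apply]
  simpa only [step, hi] using hq

theorem Reach.jle_pos {c : Config K} {t : ℕ} {Q : Config K → Prop} {a b z : ℕ}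
    (hi : P[c.pc]? = some (.jle a b z)) (hle : c.reg a ≤ c.reg b)
    (h : Reach P { c with pc := z } t Q) : Reach P c (t + 1) Q :=
  .exec hi (by simpa only [RAM.exec, if_pos hle] using h)

theorem Reach.jle_neg {c : Config K} {t : ℕ} {Q : Config K → Prop} {a b z : ℕ}
    (hi : P[c.pc]? = some (.jle a b z)) (hle : ¬ c.reg a ≤ c.reg b)
    (h : Reach P { c with pc := c.pc + 1 } t Q) : Reach P c (t + 1) Q :=
  .exec hi (by simpa only [RAM.exec, if_neg hle] using h)

theorem Reach.vjle_pos {c : Config K} {t : ℕ} {Q : Config K → Prop} {a b z : ℕ}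
    (hi : P[c.pc]? = some (.vjle a b z)) (hle : c.vreg a ≤ c.vreg b)
    (h : Reach P { c with pc := z } t Q) : Reach P c (t + 1) Q :=
  .exec hi (by simpa only [RAM.exec, if_pos hle] using h)

theorem Reach.vjle_neg {c : Config K} {t : ℕ} {Q : Config K → Prop} {a b z : ℕ}
    (hi : P[c.pc]? = some (.vjle a b z)) (hle : ¬ c.vreg a ≤ c.vreg b)
    (h : Reach P { c with pc := c.pc + 1 } t Q) : Reach P c (t + 1) Q :=
  .exec hi (by simpa only [RAM.exec, if_neg hle] using h)

/-- The program has halted with the answer `ans`. -/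
def Halted (P : Program) (ans : Prop) (c : Config K) : Prop :=
  (ans ∧ P[c.pc]? = some .accept) ∨ (¬ ans ∧ P[c.pc]? = some .reject)

theorem Halted.iterate {ans : Prop} {c : Config K} (h : Halted P ans c) (t : ℕ) :
    Halted P ans ((step P)^[t] c) := by
  have hc : step P c = c := by
    rcases h with ⟨-, h⟩ | ⟨-, h⟩ <;> simp only [step, h, exec]
  rwa [Function.iterate_fixed hc]

/-- `Reach` speaks of some moment up to `T`, `DecidesIn` of the moment `T` itself; halted
configurations are fixed by `step`, which bridges the two. -/
theorem Reach.decidesIn {x : Input K} {T : ℕ} {ans : Prop}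
    (h : Reach P (init x) T (Halted P ans)) : DecidesIn P x T ans := by
  obtain ⟨s, hs, hq⟩ := h
  have := hq.iterate (T - s)
  rwa [← Function.iterate_add_apply, Nat.sub_add_cancel hs] at this

end Reach

/-! ### The program -/

/-- The search for a small set of small expansion. Beyond the input, the first memory holds a queue
of nodes, each consisting of a vertex, a pointer to the parent node (`0` for a root) and the depth;
a node stands for the list of the vertices on the path to its root.

Registers: `2`: `n`, `3`: `k`, `4`: address of the adjacency lists, `5` and `6`: head and tail of
the queue, `7`: a node on the path from the head, `8` and `9`: position in an adjacency list and
its end, `10`: neighbour, `11`: pointer for membership tests, `13`: depth of the head. Values: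
`0`: `N`, `1`: weight of the cut, `2`: `N` times the number of vertices. -/
def sseProgram : Program := [
  .const 1 1, .load 2 0, .load 3 1, .const 4 2, .add 12 2 4, .load 6 12, .add 4 12 1, .add 6 6 4,
  .add 5 6 0, .vload 0 0,
  -- 10: one node for each vertex
  .jle 2 7 19, .store 6 7, .add 12 6 1, .store 12 0, .add 12 12 1, .store 12 1, .add 6 12 1,
  .add 7 7 1, .jle 0 0 10,
  -- 19: process the head of the queue
  .jle 6 5 66, .add 7 5 0, .vadd 1 3 3, .vadd 2 3 3, .add 12 5 1, .add 12 12 1, .load 13 12,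
  -- 26: the next vertex of the path
  .load 12 7, .add 12 12 1, .add 12 12 1, .load 8 12, .add 12 12 1, .load 9 12, .vadd 2 2 0,
  -- 33: the next neighbour
  .jle 9 8 57, .add 12 4 8, .load 10 12, .add 11 5 0,
  -- 37: is it on the path?
  .load 12 11, .jle 12 10 40, .jle 0 0 41, .jle 10 12 55, .add 11 11 1, .load 11 11, .jle 1 11 37,
  -- 44: it is not
  .add 12 8 1, .vload 4 12, .vadd 1 1 4, .jle 3 13 55, .store 6 10, .add 12 6 1, .store 12 5,
  .add 12 12 1, .add 14 13 1, .store 12 14, .add 6 12 1,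
  -- 55: end of the loop over the neighbours
  .add 8 8 1, .jle 0 0 33,
  -- 57: end of the loop over the path
  .add 7 7 1, .load 7 7, .jle 1 7 26, .vjle 1 2 65, .add 5 5 1, .add 5 5 1, .add 5 5 1, .jle 0 0 19,
  .accept, .reject]

/-! ### The queue in memory and the invariants of the search -/

variable {K : Type}

/-- Below the address `hi`, the node `p` represents the list `l`. -/
def IsNode {n : ℕ} (hi : ℕ) (mem : ℕ → ℕ) : ℕ → List (Fin n) → Prop
  | p, [] => p = 0
  | p, v :: l => 1 ≤ p ∧ p + 3 ≤ hi ∧ mem p = v ∧ mem (p + 2) = l.length + 1 ∧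
      IsNode hi mem (mem (p + 1)) l

/-- The nodes from `q` to the end `hi` of the queue represent the nonempty lists `ls`. -/
def IsQueue {n : ℕ} (hi : ℕ) (mem : ℕ → ℕ) : ℕ → List (List (Fin n)) → Prop
  | q, [] => q = hi
  | q, l :: ls => l ≠ [] ∧ IsNode hi mem q l ∧ IsQueue hi mem (q + 3) ls

/-- Every node on the path lies entirely below `hi`, so writing at or above the tail cannot disturb
it. -/
theorem IsNode.frame {n : ℕ} {hi hi' : ℕ} {mem mem' : ℕ → ℕ} (hh : hi ≤ hi')
    (hm : ∀ i < hi, mem' i = mem i) {p : ℕ} {l : List (Fin n)} (h : IsNode hi mem p l) :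
    IsNode hi' mem' p l := by
  induction l generalizing p with
  | nil => exact h
  | cons v l ih =>
    obtain ⟨h1, h2, h3, h4, h5⟩ := h
    refine ⟨h1, h2.trans hh, ?_, ?_, ?_⟩
    · rw [hm _ (by omega), h3]
    · rw [hm _ (by omega), h4]
    · rw [hm _ (by omega)]
      exact ih h5

theorem IsNode.pos {n : ℕ} {hi : ℕ} {mem : ℕ → ℕ} {p : ℕ} {l : List (Fin n)}
    (h : IsNode hi mem p l) (hl : l ≠ []) : 1 ≤ p := by
  cases l with
  | nil => exact absurd rfl hl
  | cons v l => exact h.1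

theorem IsQueue.append {n : ℕ} {hi : ℕ} {mem mem' : ℕ → ℕ} (hm : ∀ i < hi, mem' i = mem i)
    {l : List (Fin n)} (hl : l ≠ []) (hnode : IsNode (hi + 3) mem' hi l) {q : ℕ}
    {ls : List (List (Fin n))} (h : IsQueue hi mem q ls) :
    IsQueue (hi + 3) mem' q (ls ++ [l]) := by
  induction ls generalizing q with
  | nil =>
    obtain rfl : q = hi := h
    exact ⟨hl, hnode, rfl⟩
  | cons l' ls ih => exact ⟨h.1, h.2.1.frame (Nat.le_add_right _ _) hm, ih h.2.2⟩

/-- From `c` to `c'`, the lists `new` have been appended to the queue, and nothing else of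
importance has been changed. -/
structure Grows {n : ℕ} (c c' : Config K) (new : List (List (Fin n))) : Prop where
  reg : ∀ i ∈ [0, 1, 2, 3, 4, 5, 13], c'.reg i = c.reg i
  vreg : ∀ i ∈ [0, 3], c'.vreg i = c.vreg i
  vmem : c'.vmem = c.vmem
  tail : c.reg 6 ≤ c'.reg 6
  mem : ∀ i < c.reg 6, c'.mem i = c.mem i
  queue : ∀ q pend, IsQueue (c.reg 6) c.mem q pend →
    IsQueue (n := n) (c'.reg 6) c'.mem q (pend ++ new)

theorem Grows.of_eq {n : ℕ} {c c' : Config K}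
    (reg : ∀ i ∈ [0, 1, 2, 3, 4, 5, 6, 13], c'.reg i = c.reg i)
    (vreg : ∀ i ∈ [0, 3], c'.vreg i = c.vreg i) (vmem : c'.vmem = c.vmem)
    (mem : c'.mem = c.mem) : Grows (n := n) c c' [] where
  reg i hi := reg i (by simp at hi ⊢; tauto)
  vreg := vreg
  vmem := vmem
  tail := (reg 6 (by simp)).ge
  mem i _ := by rw [mem]
  queue q pend h := by rwa [reg 6 (by simp), mem, List.append_nil]

theorem Grows.trans {n : ℕ} {c₁ c₂ c₃ : Config K} {new new' : List (List (Fin n))}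
    (h : Grows c₁ c₂ new) (h' : Grows c₂ c₃ new') : Grows c₁ c₃ (new ++ new') where
  reg i hi := (h'.reg i hi).trans (h.reg i hi)
  vreg i hi := (h'.vreg i hi).trans (h.vreg i hi)
  vmem := h'.vmem.trans h.vmem
  tail := h.tail.trans h'.tail
  mem i hi := (h'.mem i (hi.trans_le h.tail)).trans (h.mem i hi)
  queue q pend hq := by
    rw [← List.append_assoc]
    exact h'.queue _ _ (h.queue _ _ hq)

/-- Extending a list takes three new cells (vertex, parent, depth): the node for `y :: l` shares the
whole path of its parent `p`. -/
theorem Grows.push {n : ℕ} {c c' : Config K} {p : ℕ} {y : Fin n} {l : List (Fin n)}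
    (reg : ∀ i ∈ [0, 1, 2, 3, 4, 5, 13], c'.reg i = c.reg i)
    (vreg : ∀ i ∈ [0, 3], c'.vreg i = c.vreg i) (vmem : c'.vmem = c.vmem)
    (tail : c'.reg 6 = c.reg 6 + 3)
    (mem : c'.mem = Function.update (Function.update (Function.update c.mem (c.reg 6) y)
      (c.reg 6 + 1) p) (c.reg 6 + 2) (l.length + 1))
    (hpos : 1 ≤ c.reg 6) (hp : IsNode (c.reg 6) c.mem p l) : Grows c c' [y :: l] where
  reg := reg
  vreg := vreg
  vmem := vmem
  tail := by omega
  mem i hi := by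
    rw [mem, Function.update_of_ne (by omega), Function.update_of_ne (by omega),
      Function.update_of_ne (by omega)]
  queue q pend hq := by
    have hm : ∀ i < c.reg 6, c'.mem i = c.mem i := fun i hi => by
      rw [mem, Function.update_of_ne (by omega), Function.update_of_ne (by omega),
        Function.update_of_ne (by omega)]
    rw [tail]
    refine hq.append hm (by simp) ?_
    refine ⟨hpos, le_rfl, ?_, ?_, ?_⟩
    · rw [mem]; simp
    · rw [mem]; simp
    · have : c'.mem (c.reg 6 + 1) = p := by rw [mem]; simp
      rw [this]
      exact hp.frame (Nat.le_add_right _ _) hm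

variable [Field K] [LinearOrder K]

/-- The parts of the configuration that describe the instance. -/
structure Holds (x : SSEInstance K) (c : Config K) : Prop where
  zero : c.reg 0 = 0
  one : c.reg 1 = 1
  size : c.reg 2 = x.n
  bound : c.reg 3 = x.k
  -- The adjacency lists are preceded by `n`, `k` and `n + 1` offsets; in the value memory the
  -- weights are shifted by one cell, which holds `N`.
  base : c.reg 4 = x.n + 3
  ratio : c.vreg 0 = x.N
  vzero : c.vreg 3 = 0
  tail : x.n + 3 + x.offset x.n ≤ c.reg 6
  offset : ∀ i ≤ x.n, c.mem (i + 2) = x.offset i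
  adj : ∀ u i, ∀ h : i < (x.adj u).length, c.mem (x.n + 3 + (x.offset u + i)) = (x.adj u)[i]
  weight : ∀ u i, ∀ h : i < (x.adj u).length,
    c.vmem (x.offset u + i + 1) = x.weight s(u, (x.adj u)[i])

theorem _root_.SSEInstance.offset_succ (x : SSEInstance K) (u : Fin x.n) :
    x.offset (u + 1) = x.offset u + (x.adj u).length := by
  unfold SSEInstance.offset
  rw [List.take_add_one]
  simp

theorem _root_.SSEInstance.offset_mono (x : SSEInstance K) : Monotone x.offset := by
  intro i j hij
  unfold SSEInstance.offset
  exact ((List.take_sublist_take_left hij).map _).sum_le_sum (by simp)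

/-- All cells that describe the instance lie below the tail of the queue. -/
theorem Holds.grows {x : SSEInstance K} {c c' : Config K} {new : List (List (Fin x.n))}
    (h : Holds x c) (hg : Grows c c' new) : Holds x c' where
  zero := (hg.reg 0 (by simp)).trans h.zero
  one := (hg.reg 1 (by simp)).trans h.one
  size := (hg.reg 2 (by simp)).trans h.size
  bound := (hg.reg 3 (by simp)).trans h.bound
  base := (hg.reg 4 (by simp)).trans h.base
  ratio := (hg.vreg 0 (by simp)).trans h.ratio
  vzero := (hg.vreg 3 (by simp)).trans h.vzero
  tail := h.tail.trans hg.tail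
  offset i hi := by rw [hg.mem _ (by have := h.tail; omega), h.offset i hi]
  adj u i hi := by
    have h1 := x.offset_succ u
    have h2 := x.offset_mono (show (u : ℕ) + 1 ≤ x.n from u.2)
    rw [hg.mem _ (by have := h.tail; omega), h.adj u i hi]
  weight u i hi := by rw [hg.vmem, h.weight u i hi]

theorem Holds.of_eq {x : SSEInstance K} {c c' : Config K} (h : Holds x c)
    (reg : ∀ i ∈ [0, 1, 2, 3, 4, 6], c'.reg i = c.reg i) (vreg : ∀ i ∈ [0, 3], c'.vreg i = c.vreg i)
    (vmem : c'.vmem = c.vmem) (mem : c'.mem = c.mem) : Holds x c' where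
  zero := (reg 0 (by simp)).trans h.zero
  one := (reg 1 (by simp)).trans h.one
  size := (reg 2 (by simp)).trans h.size
  bound := (reg 3 (by simp)).trans h.bound
  base := (reg 4 (by simp)).trans h.base
  ratio := (vreg 0 (by simp)).trans h.ratio
  vzero := (vreg 3 (by simp)).trans h.vzero
  tail := h.tail.trans (reg 6 (by simp)).ge
  offset i hi := by rw [mem, h.offset i hi]
  adj u i hi := by rw [mem, h.adj u i hi]
  weight u i hi := by rw [vmem, h.weight u i hi]

/-- The head of the queue represents the nonempty list `l`. -/
structure Head (x : SSEInstance K) (l : List (Fin x.n)) (c : Config K) : Prop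
    extends Holds x c where
  ne_nil : l ≠ []
  node : IsNode (c.reg 6) c.mem (c.reg 5) l
  depth : c.reg 13 = l.length

theorem Head.grows {x : SSEInstance K} {c c' : Config K} {l : List (Fin x.n)}
    {new : List (List (Fin x.n))} (h : Head x l c) (hg : Grows c c' new) : Head x l c' where
  toHolds := h.toHolds.grows hg
  ne_nil := h.ne_nil
  node := by
    rw [hg.reg 5 (by simp)]
    exact h.node.frame hg.tail hg.mem
  depth := (hg.reg 13 (by simp)).trans h.depth

/-! ### The loops -/

/-- Follows the parent pointers until `y` or the null pointer is met. Equality is tested by two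
comparisons, and each vertex costs at most six instructions. -/
theorem reach_membership {n hi : ℕ} (y : Fin n) (l : List (Fin n)) (hl : l ≠ []) (c : Config K)
    (hpc : c.pc = 37) (hone : c.reg 1 = 1) (hy : c.reg 10 = y)
    (hnode : IsNode hi c.mem (c.reg 11) l) :
    Reach sseProgram c (6 * l.length) fun c' =>
      ∃ reg, (∀ i, i ≠ 11 → i ≠ 12 → reg i = c.reg i) ∧
        c' = ⟨if y ∈ l then 55 else 44, reg, c.mem, c.vreg, c.vmem⟩ := by
  induction l generalizing c with
  | nil => exact absurd rfl hl
  | cons v l ih =>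
    obtain ⟨pc, reg, mem, vreg, vmem⟩ := c
    obtain rfl : pc = 37 := hpc
    obtain ⟨-, -, hv, -, hnode⟩ := hnode
    simp only at hone hy hv hnode
    rw [List.length_cons, mul_add, mul_one]
    by_cases hyv : y = v
    · subst hyv
      refine (Reach.exec (t := 2) rfl (.jle_pos rfl ?_ (.jle_pos rfl ?_ (.here ?_)))).mono
        (by omega)
      · simp [exec, hv, hy]
      · simp [exec, hv, hy]
      · refine ⟨_, ?_, by simp [exec]; rfl⟩
        intro i h1 h2
        simp [h2]
    have hne : (y : ℕ) ≠ v := fun h => hyv (Fin.ext h)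
    -- Both kinds of mismatch, `v < y` and `y < v`, continue at 41, where the pointer moves to the
    -- parent.
    have key : Reach sseProgram (K := K) ⟨41, Function.update reg 12 v, mem, vreg, vmem⟩
        (6 * l.length + 3) fun c' => ∃ reg', (∀ i, i ≠ 11 → i ≠ 12 → reg' i = reg i) ∧
          c' = ⟨if y ∈ v :: l then 55 else 44, reg', mem, vreg, vmem⟩ := by
      refine .exec rfl (.exec rfl ?_)
      rcases eq_or_ne l [] with rfl | hl'
      · refine .jle_neg rfl ?_ (.here ?_)
        · have : mem (reg 11 + 1) = 0 := hnode
          simp [exec, hone, this]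
        · refine ⟨_, ?_, by simp [exec, hyv]; rfl⟩
          intro i h1 h2
          simp [h1, h2]
      · refine .jle_pos rfl ?_ ?_
        · simpa [exec, Function.update_apply, hone] using hnode.pos hl'
        · refine (ih hl' _ rfl ?_ ?_ ?_).imp ?_
          · simpa [exec, Function.update_apply] using hone
          · simpa [exec, Function.update_apply] using hy
          · simpa [exec, Function.update_apply, hone] using hnode
          · rintro c' ⟨reg', hreg, rfl⟩
            refine ⟨reg', fun i h1 h2 => ?_, by simp [exec, hyv]⟩
            rw [hreg i h1 h2]
            simp [exec, h1, h2]
    by_cases hle : (v : ℕ) ≤ y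
    · refine .exec rfl (.jle_pos rfl ?_ (.jle_neg rfl ?_ ?_))
      · simpa [exec, hv, hy] using hle
      · simp [exec, hv, hy]
        omega
      · simpa [exec, hv] using key
    · refine .exec rfl (.jle_neg rfl ?_ (.jle_pos rfl ?_ ?_))
      · simpa [exec, hv, hy] using hle
      · simp [exec]
      · simpa [exec, hv] using key

theorem reach_neighbour (x : SSEInstance K) (l : List (Fin x.n)) (y : Fin x.n) (w : K)
    (c : Config K) (hpc : c.pc = 33) (h : Head x l c) (hlt : c.reg 8 < c.reg 9)
    (hy : c.mem (x.n + 3 + c.reg 8) = y) (hw : c.vmem (c.reg 8 + 1) = w) :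
    Reach sseProgram c (17 + 6 * l.length) fun c' => c'.pc = 33 ∧ Grows c c' (x.extend l [y]) ∧
      c'.reg 7 = c.reg 7 ∧ c'.reg 8 = c.reg 8 + 1 ∧ c'.reg 9 = c.reg 9 ∧ c'.vreg 2 = c.vreg 2 ∧
      c'.vreg 1 = c.vreg 1 + if y ∈ l then 0 else w := by
  obtain ⟨pc, reg, mem, vreg, vmem⟩ := c
  obtain rfl : pc = 33 := hpc
  have hzero := h.zero
  have hone := h.one
  have hbase := h.base
  have hbound := h.bound
  have hnode := h.node
  have hdepth := h.depth
  have htail := h.tail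
  have hne := h.ne_nil
  simp only at hlt hy hw hzero hone hbase hbound hnode hdepth htail
  -- Four instructions precede the membership test and at most thirteen follow it.
  rw [show 17 + 6 * l.length = 6 * l.length + 13 + 1 + 1 + 1 + 1 by omega]
  refine .jle_neg rfl (by simpa using hlt) (.exec rfl (.exec rfl (.exec rfl ?_)))
  refine (reach_membership (hi := reg 6) y l hne _ rfl ?_ ?_ ?_).trans ?_
  · simp [exec, hone]
  · simp [exec, hbase, hy]
  · simpa [exec, hzero] using hnode
  rintro c' ⟨reg', hreg, rfl⟩
  simp only [exec] at hreg ⊢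
  have hr : ∀ i, i ≠ 10 → i ≠ 11 → i ≠ 12 → reg' i = reg i := fun i h0 h1 h2 => by
    rw [hreg i h1 h2]
    simp [h0, h1, h2]
  have hy' : reg' 10 = y := by
    rw [hreg 10 (by norm_num) (by norm_num)]
    simp [hbase, hy]
  by_cases hyl : y ∈ l
  · refine Reach.mono (t := 2) ?_ (by omega)
    simp only [if_pos hyl]
    refine .exec rfl (.jle_pos rfl le_rfl (.here ⟨rfl, ?_, ?_, ?_, ?_, rfl, ?_⟩))
    · have : x.extend l [y] = [] := by simp [SSEInstance.extend, hyl]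
      rw [this]
      refine .of_eq ?_ (fun i _ => rfl) rfl rfl
      intro i hi
      fin_cases hi <;> simp [exec, hr]
    · simp [exec, hr]
    · simp [exec, hr, hone]
    · simp [exec, hr]
    · simp [exec]
  · simp only [if_neg hyl]
    refine .exec rfl (.exec rfl (.exec rfl ?_))
    by_cases hk : l.length < x.k
    · refine .jle_neg rfl (by simpa [exec, hr, hbound, hdepth] using hk) ?_
      refine .exec rfl (.exec rfl (.exec rfl (.exec rfl (.exec rfl (.exec rfl (.exec rfl
        (.exec rfl (.jle_pos rfl le_rfl (.here ⟨rfl, ?_, ?_, ?_, ?_, ?_, ?_⟩)))))))))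
      · have : x.extend l [y] = [y :: l] := by simp [SSEInstance.extend, hyl, hk]
        rw [this]
        refine .push (p := reg 5) ?_ ?_ rfl ?_ ?_ (by simp only; omega) hnode
        · intro i hi
          fin_cases hi <;> simp [exec, hr]
        · intro i hi
          fin_cases hi <;> simp [exec]
        · simp [exec, hr, hone]
        · simp [exec, hr, hone, hy', hdepth]
      · simp [exec, hr]
      · simp [exec, hr, hone]
      · simp [exec, hr]
      · simp [exec]
      · simp [exec, hr, hone, hw]
    · refine Reach.mono (t := 3) ?_ (by omega)
      refine .jle_pos rfl (by simpa [exec, hr, hbound, hdepth] using hk) ?_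
      refine .exec rfl (.jle_pos rfl le_rfl (.here ⟨rfl, ?_, ?_, ?_, ?_, ?_, ?_⟩))
      · have : x.extend l [y] = [] := by simp [SSEInstance.extend, hk]
        rw [this]
        refine .of_eq ?_ ?_ rfl rfl
        · intro i hi
          fin_cases hi <;> simp [exec, hr]
        · intro i hi
          fin_cases hi <;> simp [exec]
      · simp [exec, hr]
      · simp [exec, hr, hone]
      · simp [exec, hr]
      · simp [exec]
      · simp [exec, hr, hone, hw]

/-- The induction needs an arbitrary remaining segment `s` of the adjacency list. The last
hypothesis keeps the segment below the tail, so pushes do not overwrite it. -/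
theorem reach_neighbours (x : SSEInstance K) (l : List (Fin x.n)) (u : Fin x.n)
    (s : List (Fin x.n)) (c : Config K) (hpc : c.pc = 33) (h : Head x l c)
    (hend : c.reg 9 = c.reg 8 + s.length)
    (hs : ∀ i, ∀ hi : i < s.length, c.mem (x.n + 3 + (c.reg 8 + i)) = s[i] ∧
      c.vmem (c.reg 8 + i + 1) = x.weight s(u, s[i]))
    (hlt : c.reg 8 + s.length ≤ x.offset x.n) :
    Reach sseProgram c (s.length * (17 + 6 * l.length) + 1) fun c' => c'.pc = 57 ∧
      Grows c c' (x.extend l s) ∧ c'.reg 7 = c.reg 7 ∧ c'.vreg 2 = c.vreg 2 ∧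
      c'.vreg 1 = c.vreg 1 + ((s.filter (· ∉ l)).map fun y => x.weight s(u, y)).sum := by
  induction s generalizing c with
  | nil =>
    obtain ⟨pc, reg, mem, vreg, vmem⟩ := c
    obtain rfl : pc = 33 := hpc
    refine (Reach.jle_pos rfl (by simpa using hend.le) (.here ⟨rfl, ?_, rfl, rfl, ?_⟩))
    · have : x.extend l [] = [] := by simp [SSEInstance.extend]
      rw [this]
      exact .of_eq (fun _ _ => rfl) (fun _ _ => rfl) rfl rfl
    · simp
  | cons y s ih =>
    rw [List.length_cons] at hend hlt ⊢
    rw [show (s.length + 1) * (17 + 6 * l.length) + 1 =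
      (17 + 6 * l.length) + (s.length * (17 + 6 * l.length) + 1) by ring]
    obtain ⟨h1, h2⟩ := hs 0 (by simp)
    refine (reach_neighbour x l y _ c hpc h (by omega) h1 h2).trans ?_
    rintro c₁ ⟨hpc₁, hg₁, h7₁, h8₁, h9₁, hv2₁, hv1₁⟩
    have htail := h.tail
    refine (ih c₁ hpc₁ (h.grows hg₁) (by omega) ?_ (by omega)).imp ?_
    · intro i hi
      obtain ⟨h3, h4⟩ := hs (i + 1) (by simpa using hi)
      rw [List.getElem_cons_succ] at h3 h4
      rw [hg₁.vmem, hg₁.mem _ (by omega), h8₁, ← h3, ← h4, add_assoc (c.reg 8),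
        add_comm 1 i]
      exact ⟨rfl, rfl⟩
    · rintro c₂ ⟨hpc₂, hg₂, h7₂, hv2₂, hv1₂⟩
      refine ⟨hpc₂, ?_, h7₂.trans h7₁, hv2₂.trans hv2₁, ?_⟩
      · have : x.extend l (y :: s) = x.extend l [y] ++ x.extend l s := by
          unfold SSEInstance.extend
          split
          · rw [← List.map_append, ← List.filter_append, List.singleton_append]
          · rfl
        rw [this]
        exact hg₁.trans hg₂
      · rw [hv1₂, hv1₁]
        by_cases hyl : y ∈ l <;> simp [hyl, add_assoc]

theorem reach_path_vertex (x : SSEInstance K) (l : List (Fin x.n)) (u : Fin x.n) (c : Config K)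
    (hpc : c.pc = 26) (h : Head x l c) (hu : c.mem (c.reg 7) = u) :
    Reach sseProgram c ((x.adj u).length * (17 + 6 * l.length) + 8) fun c' => c'.pc = 57 ∧
      Grows c c' (x.extend l (x.adj u)) ∧ c'.reg 7 = c.reg 7 ∧ c'.vreg 2 = c.vreg 2 + x.N ∧
      c'.vreg 1 = c.vreg 1 + ((x.outer l u).map fun y => x.weight s(u, y)).sum := by
  have hadj := h.adj u
  have hweight := h.weight u
  have hoff := h.offset u u.2.le
  have hoff' := h.offset (u + 1) u.2
  have hone := h.one
  have hratio := h.ratio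
  obtain ⟨pc, reg, mem, vreg, vmem⟩ := c
  obtain rfl : pc = 26 := hpc
  simp only at hu hadj hweight hoff hoff' hone hratio
  have hle := (x.offset_succ u).ge.trans (x.offset_mono (show (u : ℕ) + 1 ≤ x.n from u.2))
  refine .exec rfl (.exec rfl (.exec rfl (.exec rfl (.exec rfl (.exec rfl (.exec rfl ?_))))))
  have hoff'' : mem (u + 2 + 1) = x.offset u + (x.adj u).length := by
    rw [← x.offset_succ, ← hoff', add_right_comm]
  have h8 : mem (u + 1 + 1) = x.offset u := hoff
  refine (reach_neighbours x l u (x.adj u) _ rfl (h.grows (.of_eq ?_ ?_ ?_ ?_)) ?_ ?_ ?_).imp ?_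
  · intro i hi
    fin_cases hi <;> simp [exec]
  · intro i hi
    fin_cases hi <;> simp [exec]
  · rfl
  · rfl
  · simp [exec, hu, hone, h8, hoff'']
  · intro i hi
    simpa [exec, hu, hone, h8] using ⟨hadj i hi, hweight i hi⟩
  · simpa [exec, hu, hone, h8] using hle
  · rintro c' ⟨hpc, hg, h7, hv2, hv1⟩
    refine ⟨hpc, ?_, ?_, ?_, ?_⟩
    · rw [← List.nil_append (x.extend l (x.adj u))]
      refine Grows.trans (.of_eq ?_ ?_ ?_ ?_) hg
      · intro i hi
        fin_cases hi <;> simp [exec]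
      · intro i hi
        fin_cases hi <;> simp [exec]
      · rfl
      · rfl
    · simp [h7, exec]
    · simp [hv2, exec, hratio]
    · simp [hv1, exec, SSEInstance.outer]

/-- The induction runs over the unvisited part `la` of the path, while membership is always tested
against the full list `l`. -/
theorem reach_path (x : SSEInstance K) (l : List (Fin x.n)) {d : ℕ}
    (hd : ∀ u, (x.adj u).length ≤ d) (la : List (Fin x.n)) (hla : la ≠ []) (c : Config K)
    (hpc : c.pc = 26) (h : Head x l c) (hnode : IsNode (c.reg 6) c.mem (c.reg 7) la) :
    Reach sseProgram c (la.length * (d * (17 + 6 * l.length) + 11)) fun c' => c'.pc = 60 ∧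
      Grows c c' (la.flatMap fun u => x.extend l (x.adj u)) ∧
      c'.vreg 1 = c.vreg 1 +
        (la.map fun u => ((x.outer l u).map fun y => x.weight s(u, y)).sum).sum ∧
      c'.vreg 2 = c.vreg 2 + (la.map fun _ => (x.N : K)).sum := by
  induction la generalizing c with
  | nil => exact absurd rfl hla
  | cons u la ih =>
    obtain ⟨-, hp, hu, -, hnode⟩ := hnode
    rw [List.length_cons, show (la.length + 1) * (d * (17 + 6 * l.length) + 11) =
      (d * (17 + 6 * l.length) + 8) + (la.length * (d * (17 + 6 * l.length) + 11) + 1 + 1 + 1)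
      by ring]
    refine ((reach_path_vertex x l u c hpc h hu).mono
      (Nat.add_le_add_right (Nat.mul_le_mul_right _ (hd u)) _)).trans ?_
    rintro c₁ ⟨hpc₁, hg₁, h7₁, hv2₁, hv1₁⟩
    have h₁ := h.grows hg₁
    have hnode₁ : IsNode (c₁.reg 6) c₁.mem (c₁.mem (c₁.reg 7 + 1)) la := by
      rw [h7₁, hg₁.mem _ (by omega)]
      exact hnode.frame hg₁.tail hg₁.mem
    have hone := h₁.one
    obtain ⟨pc, reg, mem, vreg, vmem⟩ := c₁
    obtain rfl : pc = 57 := hpc₁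
    simp only at hv2₁ hv1₁ hone hnode₁
    have hg₂ : ∀ pc, Grows (n := x.n) ⟨57, reg, mem, vreg, vmem⟩
        ⟨pc, Function.update (Function.update reg 7 (reg 7 + 1)) 7 (mem (reg 7 + 1)), mem, vreg,
          vmem⟩ [] := by
      refine fun pc => .of_eq ?_ (fun _ _ => rfl) rfl rfl
      intro i hi
      fin_cases hi <;> simp
    refine .exec rfl (.exec rfl ?_)
    simp only [exec, hone, Function.update_self]
    rcases eq_or_ne la [] with rfl | hla'
    · refine .jle_neg rfl ?_ (.here ⟨rfl, ?_, ?_, ?_⟩)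
      · have : mem (reg 7 + 1) = 0 := hnode₁
        simp [hone, this]
      · simpa using hg₁.trans (hg₂ 60)
      · simpa using hv1₁
      · simpa using hv2₁
    · refine .jle_pos rfl ?_ ?_
      · simpa [hone] using hnode₁.pos hla'
      · refine (ih hla' _ rfl (h₁.grows (hg₂ 26)) ?_).imp ?_
        · simpa using hnode₁
        · rintro c' ⟨hpc', hg', hv1', hv2'⟩
          refine ⟨hpc', ?_, ?_, ?_⟩
          · simpa using hg₁.trans ((hg₂ 26).trans hg')
          · refine hv1'.trans ?_
            simp [hv1₁, add_assoc]
          · refine hv2'.trans ?_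
            simp [hv2₁, add_assoc]

/-! ### Counting the generated lists and correctness of the search -/

/-- A bound on the number of lists that are generated from the lists in `pend`. -/
def potential (x : SSEInstance K) (d : ℕ) (pend : List (List (Fin x.n))) : ℕ :=
  (pend.map fun l => (1 + x.k * d) ^ (x.k - l.length)).sum

/-- With `B = 1 + k * d`, at most `k * d` children of potential `B ^ r` replace a list of potential
`B ^ (r + 1) = B ^ r + k * d * B ^ r`. So replacing a list by its children lowers the potential by
at least one. -/
theorem potential_children (x : SSEInstance K) {d : ℕ} (hd : ∀ u, (x.adj u).length ≤ d)
    (l : List (Fin x.n)) :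
    potential x d (x.children l) + 1 ≤ (1 + x.k * d) ^ (x.k - l.length) := by
  by_cases hk : l.length < x.k
  · have hcard : (x.children l).length ≤ x.k * d := by
      unfold SSEInstance.children
      rw [List.length_flatMap]
      refine (List.sum_le_card_nsmul _ d ?_).trans ?_
      · simp only [List.mem_map, forall_exists_index, and_imp]
        rintro _ u - rfl
        simp only [SSEInstance.extend, if_pos hk, List.length_map]
        exact (List.length_filter_le _ _).trans (hd u)
      · simpa using Nat.mul_le_mul_right d hk.le
    have hsum : potential x d (x.children l) ≤
        (x.children l).length * (1 + x.k * d) ^ (x.k - (l.length + 1)) := by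
      unfold potential
      refine (List.sum_le_card_nsmul _ ((1 + x.k * d) ^ (x.k - (l.length + 1))) ?_).trans (by simp)
      simp only [List.mem_map, forall_exists_index, and_imp]
      rintro _ l' hl' rfl
      obtain ⟨-, u, -, y, -, -, rfl⟩ := SSEInstance.mem_children.1 hl'
      rfl
    obtain ⟨r, hr⟩ : ∃ r, x.k - l.length = r + 1 := ⟨x.k - l.length - 1, by omega⟩
    rw [show x.k - (l.length + 1) = r by omega] at hsum
    rw [hr, pow_succ]
    have h1 := Nat.one_le_pow r (1 + x.k * d) (by omega)
    nlinarith [Nat.mul_le_mul_right ((1 + x.k * d) ^ r) hcard]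
  · have : x.children l = [] := by
      rw [List.eq_nil_iff_forall_not_mem]
      exact fun l' hl' => hk (SSEInstance.mem_children.1 hl').1
    rw [this]
    simpa [potential] using Nat.one_le_pow _ (1 + x.k * d) (by omega)

theorem reach_start_head (x : SSEInstance K) (l : List (Fin x.n)) (pend : List (List (Fin x.n)))
    (c : Config K) (hpc : c.pc = 19) (h : Holds x c)
    (hq : IsQueue (c.reg 6) c.mem (c.reg 5) (l :: pend)) :
    Reach sseProgram c 7 fun c' => c'.pc = 26 ∧ Head x l c' ∧
      IsNode (c'.reg 6) c'.mem (c'.reg 7) l ∧ c'.vreg 1 = 0 ∧ c'.vreg 2 = 0 ∧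
      IsQueue (c'.reg 6) c'.mem (c'.reg 5 + 3) pend := by
  obtain ⟨hnil, hnode, hq⟩ := hq
  have hone := h.one
  have hzero := h.zero
  have hvzero := h.vzero
  obtain ⟨pc, reg, mem, vreg, vmem⟩ := c
  obtain rfl : pc = 19 := hpc
  simp only at hnode hq hone hzero hvzero
  have hbase : reg 5 + 3 ≤ reg 6 ∧ mem (reg 5 + 2) = l.length := by
    cases l with
    | nil => exact absurd rfl hnil
    | cons v l => exact ⟨hnode.2.1, hnode.2.2.2.1⟩
  obtain ⟨hlt, hdepth⟩ := hbase
  refine .jle_neg rfl (by simp; omega) (.exec rfl (.exec rfl (.exec rfl (.exec rfl (.exec rfl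
    (.exec rfl (.here ⟨rfl, ⟨h.of_eq ?_ ?_ ?_ ?_, hnil, ?_, ?_⟩, ?_, ?_, ?_, ?_⟩)))))))
  · intro i hi
    fin_cases hi <;> simp [exec]
  · intro i hi
    fin_cases hi <;> simp [exec]
  · rfl
  · rfl
  · simpa [exec] using hnode
  · simpa [exec, hone] using hdepth
  · simpa [exec, hzero] using hnode
  · simp [exec, hvzero]
  · simp [exec, hvzero]
  · simpa [exec] using hq

theorem reach_head (x : SSEInstance K) {d : ℕ} (hd : ∀ u, (x.adj u).length ≤ d)
    (l : List (Fin x.n)) (pend : List (List (Fin x.n))) (hv : x.Valid l) (c : Config K)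
    (hpc : c.pc = 19) (h : Holds x c) (hq : IsQueue (c.reg 6) c.mem (c.reg 5) (l :: pend)) :
    Reach sseProgram c (x.k * (d * (17 + 6 * x.k) + 11) + 12) fun c' =>
      (x.Good l ∧ c'.pc = 65) ∨ (¬ x.Good l ∧ c'.pc = 19 ∧ Holds x c' ∧
        IsQueue (c'.reg 6) c'.mem (c'.reg 5) (pend ++ x.children l)) := by
  have hle : l.length * (d * (17 + 6 * l.length) + 11) ≤ x.k * (d * (17 + 6 * x.k) + 11) := by
    have := hv.length_le
    gcongr
  rw [show x.k * (d * (17 + 6 * x.k) + 11) + 12 =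
    7 + (x.k * (d * (17 + 6 * x.k) + 11) + 1 + 1 + 1 + 1 + 1) by ring]
  refine (reach_start_head x l pend c hpc h hq).trans ?_
  rintro c₁ ⟨hpc₁, h₁, hnode₁, hv1₁, hv2₁, hq₁⟩
  refine ((reach_path x l hd l hv.ne_nil c₁ hpc₁ h₁ hnode₁).mono hle).trans (t₂ := 5) ?_
  rintro c₂ ⟨hpc₂, hg₂, hv1₂, hv2₂⟩
  have h₂ := h₁.toHolds.grows hg₂
  have hq₂ := hg₂.queue _ _ hq₁
  rw [← hg₂.reg 5 (by simp)] at hq₂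
  have hgood : c₂.vreg 1 ≤ c₂.vreg 2 ↔ x.Good l := by
    rw [hv1₂, hv2₂, hv1₁, hv2₁, zero_add, zero_add]
    rfl
  have hone := h₂.one
  obtain ⟨pc, reg, mem, vreg, vmem⟩ := c₂
  obtain rfl : pc = 60 := hpc₂
  by_cases hle' : vreg 1 ≤ vreg 2
  · exact .vjle_pos rfl hle' (.here (.inl ⟨hgood.1 hle', rfl⟩))
  · refine .vjle_neg rfl hle' (.exec rfl (.exec rfl (.exec rfl (.jle_pos rfl le_rfl (.here (.inr
      ⟨fun hg => hle' (hgood.2 hg), rfl, h₂.of_eq ?_ ?_ ?_ ?_, ?_⟩))))))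
    · intro i hi
      fin_cases hi <;> simp [exec]
    · intro i hi
      rfl
    · rfl
    · rfl
    · simp only at hone
      simpa [exec, hone, add_assoc, SSEInstance.children] using hq₂

/-- The potential bounds the number of rounds. The invariant is the answer itself: if the head is
not good, its good descendants are those of its children, so replacing it by them changes nothing.
The final step is the jump to `reject` on an empty queue. -/
theorem reach_answer (x : SSEInstance K) {d : ℕ} (hd : ∀ u, (x.adj u).length ≤ d) (f : ℕ)
    (pend : List (List (Fin x.n))) (hf : potential x d pend ≤ f) (hv : ∀ l ∈ pend, x.Valid l)
    (c : Config K) (hpc : c.pc = 19) (h : Holds x c)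
    (hq : IsQueue (c.reg 6) c.mem (c.reg 5) pend) :
    Reach sseProgram c (f * (x.k * (d * (17 + 6 * x.k) + 11) + 12) + 1)
      (Halted sseProgram (∃ l ∈ pend, ∃ l', x.Desc l l' ∧ x.Good l')) := by
  induction f using Nat.strong_induction_on generalizing pend c with
  | h f ih =>
    rcases pend with _ | ⟨l, pend⟩
    · obtain ⟨pc, reg, mem, vreg, vmem⟩ := c
      obtain rfl : pc = 19 := hpc
      exact Reach.mono (.jle_pos (t := 0) rfl hq.ge (.here (.inr ⟨by simp, rfl⟩))) (by omega)
    · have hpot := potential_children x hd l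
      have hf' : (1 + x.k * d) ^ (x.k - l.length) + potential x d pend ≤ f := hf
      obtain ⟨g, rfl⟩ : ∃ g, f = g + 1 := ⟨f - 1, by omega⟩
      rw [add_mul, one_mul, add_comm (g * _), add_assoc]
      refine (reach_head x hd l pend (hv l (by simp)) c hpc h hq).trans ?_
      rintro c' (⟨hgood, hpc'⟩ | ⟨hgood, hpc', h', hq'⟩)
      · exact .here (.inl ⟨⟨l, by simp, l, .refl, hgood⟩, by rw [hpc']; rfl⟩)
      · have hans : (∃ l' ∈ l :: pend, ∃ l'', x.Desc l' l'' ∧ x.Good l'') =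
            ∃ l' ∈ pend ++ x.children l, ∃ l'', x.Desc l' l'' ∧ x.Good l'' := by
          apply propext
          constructor
          · rintro ⟨l', hl', l'', hd, hg⟩
            rcases List.mem_cons.1 hl' with rfl | hl'
            · rcases Relation.ReflTransGen.cases_head hd with rfl | ⟨l₁, hl₁, hd⟩
              · exact absurd hg hgood
              · exact ⟨l₁, List.mem_append_right _ hl₁, l'', hd, hg⟩
            · exact ⟨l', List.mem_append_left _ hl', l'', hd, hg⟩
          · rintro ⟨l', hl', l'', hd, hg⟩
            rcases List.mem_append.1 hl' with hl' | hl'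
            · exact ⟨l', List.mem_cons_of_mem _ hl', l'', hd, hg⟩
            · exact ⟨l, List.mem_cons_self, l'', .head hl' hd, hg⟩
        rw [hans]
        refine ih g (by omega) _ ?_ ?_ c' hpc' h' hq'
        · have : potential x d (pend ++ x.children l) =
              potential x d pend + potential x d (x.children l) := by simp [potential]
          omega
        · intro l' hl'
          rcases List.mem_append.1 hl' with hl' | hl'
          · exact hv l' (List.mem_cons_of_mem _ hl')
          · exact (hv l List.mem_cons_self).child hl'

/-! ### Initialising the queue and reading the input layout -/

theorem reach_roots (x : SSEInstance K) (m : ℕ) (c : Config K) (hpc : c.pc = 10) (h : Holds x c)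
    (hm : c.reg 7 + m = x.n) :
    Reach sseProgram c (m * 9 + 1) fun c' => c'.pc = 19 ∧
      Grows c c' (((List.finRange x.n).drop (c.reg 7)).map fun v => [v]) := by
  induction m generalizing c with
  | zero =>
    have hsize := h.size
    obtain ⟨pc, reg, mem, vreg, vmem⟩ := c
    obtain rfl : pc = 10 := hpc
    refine Reach.jle_pos rfl (by simp only at hsize hm ⊢; omega) (.here ⟨rfl, ?_⟩)
    rw [List.drop_eq_nil_of_le (by simp only [List.length_finRange] at hm ⊢; omega)]
    exact .of_eq (fun _ _ => rfl) (fun _ _ => rfl) rfl rfl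
  | succ m ih =>
    have hsize := h.size
    have hone := h.one
    have hzero := h.zero
    have htail := h.tail
    obtain ⟨pc, reg, mem, vreg, vmem⟩ := c
    obtain rfl : pc = 10 := hpc
    simp only at hsize hone hzero htail hm
    have hlt : reg 7 < x.n := by omega
    rw [show (m + 1) * 9 + 1 = 9 + (m * 9 + 1) by ring]
    have hstep : Reach sseProgram (⟨10, reg, mem, vreg, vmem⟩ : Config K) 9 fun c' => c'.pc = 10 ∧
        c'.reg 7 = reg 7 + 1 ∧
        Grows ⟨10, reg, mem, vreg, vmem⟩ c' [[(⟨reg 7, hlt⟩ : Fin x.n)]] := by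
      refine .jle_neg rfl (by simp only; omega) (.exec rfl (.exec rfl (.exec rfl (.exec rfl
        (.exec rfl (.exec rfl (.exec rfl (.jle_pos rfl le_rfl (.here ⟨rfl, ?_, ?_⟩)))))))))
      · simp [exec, hone]
      · refine .push (p := 0) ?_ (fun _ _ => rfl) rfl ?_ ?_ (by simp only; omega) rfl
        · intro i hi
          fin_cases hi <;> simp [exec]
        · simp [exec, hone]
        · simp [exec, hone, hzero]
    refine hstep.trans ?_
    rintro c' ⟨hpc', h7, hg⟩
    refine (ih c' hpc' (h.grows hg) (by omega)).imp ?_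
    rintro c'' ⟨hpc'', hg'⟩
    refine ⟨hpc'', ?_⟩
    rw [List.drop_eq_getElem_cons (by simpa using hlt)]
    rw [h7] at hg'
    simpa using hg.trans hg'

/-- Shows that the offsets locate the adjacency lists and weights: the blocks before the `j`-th have
exactly the offset as total length. -/
theorem getElem?_flatMap_offset {α β : Type*} (f : α → List β) (l : List α) (j i : ℕ)
    (hj : j < l.length) (hi : i < (f l[j]).length) :
    (l.flatMap f)[((l.take j).map fun v => (f v).length).sum + i]? = some (f l[j])[i] := by
  have hsplit : l.flatMap f =
      (l.take j).flatMap f ++ (f l[j] ++ (l.drop (j + 1)).flatMap f) := by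
    rw [← List.flatMap_cons, ← List.drop_eq_getElem_cons hj, ← List.flatMap_append,
      List.take_append_drop]
  rw [hsplit, ← List.length_flatMap, List.getElem?_append_right (Nat.le_add_right _ _),
    Nat.add_sub_cancel_left, List.getElem?_append_left hi, List.getElem?_eq_getElem hi]

theorem _root_.SSEInstance.input_nats (x : SSEInstance K) :
    x.input.nats = [x.n, x.k] ++ (List.range (x.n + 1)).map x.offset ++
      (List.finRange x.n).flatMap fun v => (x.adj v).map Fin.val := by
  simp [SSEInstance.input, List.map_eq_flatMap]

theorem reach_roots_start (x : SSEInstance K) :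
    Reach sseProgram (init x.input) 10 fun c => c.pc = 10 ∧ Holds x c ∧ c.reg 7 = 0 ∧
      c.reg 5 = c.reg 6 := by
  have h0 : x.input.nats.getD 0 0 = x.n := by simp [SSEInstance.input]
  have h1 : x.input.nats.getD 1 0 = x.k := by simp [SSEInstance.input]
  have hoff : ∀ i ≤ x.n, x.input.nats.getD (i + 2) 0 = x.offset i := by
    intro i hi
    rw [x.input_nats, List.getD_eq_getElem?_getD, List.getElem?_append_left
      (by simpa using Nat.lt_succ_of_le hi)]
    simp [Nat.lt_succ_of_le hi]
  have hadj : ∀ u i, ∀ h : i < (x.adj u).length,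
      x.input.nats.getD (x.n + 3 + (x.offset u + i)) 0 = (x.adj u)[i] := by
    intro u i h
    have := getElem?_flatMap_offset (fun v => (x.adj v).map Fin.val) (List.finRange x.n) u i
      (by simp) (by simpa using h)
    rw [x.input_nats, List.getD_eq_getElem?_getD, List.getElem?_append_right (by simp)]
    simp only [List.length_map] at this
    have hlen : x.n + 3 + (x.offset u + i) -
      ([x.n, x.k] ++ List.map x.offset (List.range (x.n + 1))).length = x.offset u + i := by
      simp
    rw [hlen, SSEInstance.offset, this]
    simp
  have hw : ∀ u i, ∀ h : i < (x.adj u).length,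
      x.input.vals.getD (x.offset u + i + 1) 0 = x.weight s(u, (x.adj u)[i]) := by
    intro u i h
    have := getElem?_flatMap_offset (fun v => (x.adj v).map fun u => x.weight s(v, u))
      (List.finRange x.n) u i (by simp) (by simpa using h)
    simp only [List.length_map] at this
    simp only [SSEInstance.input, List.getD_eq_getElem?_getD, List.singleton_append,
      List.getElem?_cons_succ]
    rw [SSEInstance.offset, this]
    simp
  refine .exec rfl (.exec rfl (.exec rfl (.exec rfl (.exec rfl (.exec rfl (.exec rfl (.exec rfl
    (.exec rfl (.exec rfl (.here ⟨rfl, ?_, ?_, ?_⟩))))))))))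
  · have h2 : 2 + x.n = x.n + 2 := add_comm _ _
    constructor
    case offset => intro i hi; exact hoff i hi
    case adj => exact hadj
    case weight => exact hw
    case tail =>
      simp [exec, init, -List.getD_eq_getElem?_getD, h0, hoff x.n le_rfl]
      omega
    case ratio => simp [exec, init, SSEInstance.input]
    all_goals simp [exec, init, -List.getD_eq_getElem?_getD, h0, h1]
  · simp [exec, init]
  · simp [exec, init]

/-- Each root costs nine steps to create and has potential at most `(1 + k * d) ^ k`. The constant
12 is ten start-up instructions and the two exits from the root and queue loops. -/
theorem sse_decidesIn [IsStrictOrderedRing K] (x : SSEInstance K) {d : ℕ}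
    (hd : ∀ u, (x.adj u).length ≤ d) :
    DecidesIn sseProgram x.input
      (x.n * ((1 + x.k * d) ^ x.k * (x.k * (d * (17 + 6 * x.k) + 11) + 12) + 9) + 12) x.Yes := by
  have hpot : potential x d ((List.finRange x.n).map fun v => [v]) ≤
      x.n * (1 + x.k * d) ^ x.k := by
    unfold potential
    refine (List.sum_le_card_nsmul _ ((1 + x.k * d) ^ x.k) ?_).trans (by simp)
    simp only [List.mem_map, forall_exists_index, and_imp]
    rintro _ _ v - rfl rfl
    exact Nat.pow_le_pow_right (by omega) (Nat.sub_le _ _)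
  have hans : x.Yes =
      ∃ l ∈ (List.finRange x.n).map fun v => [v], ∃ l', x.Desc l l' ∧ x.Good l' := by
    rw [x.yes_iff]
    simp
  refine Reach.decidesIn (((reach_roots_start x).trans (t₂ := x.n * 9 + 1 +
    (x.n * (1 + x.k * d) ^ x.k * (x.k * (d * (17 + 6 * x.k) + 11) + 12) + 1)) ?_).mono ?_)
  · rintro c ⟨hpc, h, h7, h56⟩
    refine (reach_roots x x.n c hpc h (by omega)).trans ?_
    rintro c' ⟨hpc', hg⟩
    rw [h7, List.drop_zero] at hg
    rw [hans]
    refine reach_answer x hd _ _ hpot ?_ c' hpc' (h.grows hg) ?_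
    · simp only [List.mem_map, forall_exists_index, and_imp]
      rintro _ v - rfl
      exact ⟨by simp, by simp, x.k_pos⟩
    · rw [hg.reg 5 (by simp)]
      -- Head and tail coincide before the roots are pushed, that is, the queue is empty.
      exact hg.queue (c.reg 5) [] h56
  · exact le_of_eq (by ring)

theorem sseProgram_constLT {b : ℕ} (hb : 2 < b) : ∀ i ∈ sseProgram, i.ConstLT b := by
  intro i hi
  simp only [sseProgram, List.mem_cons, List.not_mem_nil, or_false] at hi
  rcases i with _ | _ | _ | _ | _ | _ | _ | _ | _ | _ | _ | _ | _ <;> try trivial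
  simp at hi
  simp only [Instr.ConstLT]
  omega

end RAM

/-! ### The resource bounds in terms of `n`, the maximum degree and the input size -/

namespace SSEInstance

variable {K : Type} [Field K] [LinearOrder K]

theorem length_adj_le (x : SSEInstance K) (u : Fin x.n) : (x.adj u).length ≤ x.maxDegree := by
  classical
  have h : (x.adj u).toFinset = x.graph.neighborFinset u := by
    ext y
    simp [x.mem_adj]
  rw [← List.toFinset_card_of_nodup (x.adj_nodup u), h, SimpleGraph.card_neighborFinset_eq_degree]
  unfold maxDegree
  convert x.graph.degree_le_maxDegree u

/-- Although `n` is written in binary, the `n + 1` offsets each contribute at least their separator,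
so linear in `n` implies linear in the input size. -/
theorem n_lt_size (x : SSEInstance ℚ) : x.n < x.input.size := by
  unfold RAM.Input.size
  have h : x.input.nats.length ≤ (x.input.nats.map fun m => m.size + 1).sum := by
    simp
  have h' : x.n + 3 ≤ x.input.nats.length := by
    simp only [input, List.length_append, List.length_cons, List.length_map, List.length_range]
    omega
  omega

end SSEInstance

/-- The factor in the bound on the number of steps. -/
def sseFactor (k d : ℕ) : ℕ := (1 + k * d) ^ k * (k * (d * (17 + 6 * k) + 11) + 12) + 21

theorem primrec_sseFactor : Primrec₂ sseFactor := by
  have hk : Primrec fun p : ℕ × ℕ => p.1 := .fst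
  have hd : Primrec fun p : ℕ × ℕ => p.2 := .snd
  have hc : ∀ c : ℕ, Primrec fun _ : ℕ × ℕ => c := fun c => .const c
  have hpow : Primrec₂ fun a b : ℕ => a ^ b := Primrec₂.unpaired'.1 Nat.Primrec.pow
  have add {f g : ℕ × ℕ → ℕ} (hf : Primrec f) (hg : Primrec g) : Primrec fun p => f p + g p :=
    Primrec.nat_add.comp hf hg
  have mul {f g : ℕ × ℕ → ℕ} (hf : Primrec f) (hg : Primrec g) : Primrec fun p => f p * g p :=
    Primrec.nat_mul.comp hf hg
  exact add (mul (hpow.comp (add (hc 1) (mul hk hd)) hk)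
    (add (mul hk (add (mul hd (add (hc 17) (mul (hc 6) hk))) (hc 11))) (hc 12))) (hc 21)

/-- Since `1 ≤ m`, the additive 12 is absorbed into the factor: `9 + 12 = 21`. It serves both with
`m` the input size and with `m = n * log n + 1`. -/
theorem step_bound_le (k d : ℕ) {n m : ℕ} (hn : n ≤ m) (hm : 1 ≤ m) :
    n * ((1 + k * d) ^ k * (k * (d * (17 + 6 * k) + 11) + 12) + 9) + 12 ≤ sseFactor k d * m := by
  unfold sseFactor
  generalize (1 + k * d) ^ k * (k * (d * (17 + 6 * k) + 11) + 12) = a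
  calc n * (a + 9) + 12 ≤ m * (a + 9) + 12 * m :=
        Nat.add_le_add (Nat.mul_le_mul_right _ hn) (by omega)
    _ = (a + 21) * m := by ring

theorem mainTheorem6 :
    ∃ P : RAM.Program,
      kSSE.IsFixedParameterAlgorithm P ∧
      ∃ f : ℕ → ℕ → ℕ, Computable₂ f ∧
        ∀ (K : Type) [Field K] [LinearOrder K] [IsStrictOrderedRing K] (x : SSEInstance K),
          ∃ T : ℕ, T ≤ f x.k x.maxDegree * (x.n * Nat.log 2 x.n + 1) ∧
            RAM.DecidesIn P x.input T x.Yes := by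
  refine ⟨RAM.sseProgram, ⟨fun p => sseFactor p.1 p.2 * (13 + 4 * sseFactor p.1 p.2), 2, ?_, ?_⟩,
    sseFactor, primrec_sseFactor.to_comp, ?_⟩
  · have hf : Primrec fun p : ℕ × ℕ => sseFactor p.1 p.2 := primrec_sseFactor
    exact (Primrec.nat_mul.comp hf
      (Primrec.nat_add.comp (.const 13) (Primrec.nat_mul.comp (.const 4) hf))).to_comp
  · intro x
    refine ⟨_, RAM.sse_decidesIn (K := ℚ) x (SSEInstance.length_adj_le x), ?_⟩
    have hn := SSEInstance.n_lt_size x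
    have hT := step_bound_le x.k x.maxDegree (show x.n ≤ x.input.size by omega)
      (show 1 ≤ x.input.size by omega)
    refine (RAM.bitCost_le (RAM.sseProgram_constLT ?_) _).trans ?_
    · calc 2 < 2 ^ 2 := by norm_num
        _ ≤ 2 ^ (2 * x.input.size + 1) := Nat.pow_le_pow_right (by norm_num) (by omega)
    · change _ ≤ sseFactor x.k x.maxDegree * (13 + 4 * sseFactor x.k x.maxDegree) *
        x.input.size ^ 2
      refine (Nat.mul_le_mul hT (Nat.add_le_add_left (Nat.mul_le_mul_left 4
        (Nat.add_le_add_left hT _)) 1)).trans ?_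
      set F := sseFactor x.k x.maxDegree
      set X := x.input.size
      -- The left side is `5 + 8 * X + 4 * F * X`, and `5 ≤ 5 * X`.
      have h1 : 1 + 4 * (2 * X + 1 + F * X) ≤ (13 + 4 * F) * X := by
        have : 1 ≤ X := by omega
        linarith
      calc F * X * (1 + 4 * (2 * X + 1 + F * X)) ≤ F * X * ((13 + 4 * F) * X) :=
            Nat.mul_le_mul_left _ h1
        _ = F * (13 + 4 * F) * X ^ 2 := by ring
  · intro K _ _ _ x
    refine ⟨_, step_bound_le x.k x.maxDegree ?_ (Nat.le_add_left _ _),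
      RAM.sse_decidesIn x x.length_adj_le⟩
    -- For `n ≤ 1` the summand 1 suffices; for `n ≥ 2` the logarithm is at least 1.
    rcases Nat.lt_or_ge x.n 2 with h | h
    · omega
    · exact (Nat.le_mul_of_pos_right _ (Nat.log_pos (by norm_num) h)).trans (Nat.le_succ _)
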